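/- **Theorem 1.2.** Let $p\in[1,2)$ and let $(k_n)_{n\ge 1}$ be integers with $1\le k_n\le n$ such that $\lambda:=\lim_{n\to\infty} k_n/n$ exists and lies in $(0,1]$. For every $n\ge1$ let $X^{(n)}$ be a random vector uniformly distributed in the ball $\mathbb B_p^n=\{x\in\mathbb R^n:(\sum_{i=1}^n|x_i|^p)^{1/p}\le 1\}$, and let $E^{(n)}$ be a random $k_n$-dimensional linear subspace of $\mathbb R^n$, independent of $X^{(n)}$ and distributed according to the Haar probability measure on the Grassmannian $\mathbb G_{n,k_n}$, i.e. the image of the Haar probability measure of the orthogonal group $\mathcal O(n)$ under $T\mapsto T\,\mathrm{span}\{e_1,\dots,e_{k_n}\}$; all random variables live on one probability space $(\Omega,\mathcal F,\mathbb P)$. Let $P_{E^{(n)}}$ be the orthogonal projection onto $E^{(n)}$, $\|\cdot\|_2$ the Euclidean norm, and $$Y^{(n)}:=n^{\frac1p-\frac12}\,\big\|P_{E^{(n)}}X^{(n)}\big\|_2 .$$ Put $$m_p:=\frac{p^{2/p}}{3}\,\frac{\Gamma(1+\frac3p)}{\Gamma(1+\frac1p)},\qquad \mathcal I(y):=\begin{cases}\frac1p\Big(\frac{y^2}{\lambda}-m_p\Big)^{p/2}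 & y\ge\sqrt{\lambda m_p},\\ +\infty & \text{otherwise.}\end{cases}$$ Then $m_p=\mathbb E Z^2$ for a $p$-generalized Gaussian random variable $Z$, i.e. one with Lebesgue density $f_p(x)=\big(2p^{1/p}\Gamma(1+\frac1p)\big)^{-1}e^{-|x|^p/p}$ on $\mathbb R$, and the sequence $(Y^{(n)})_{n\ge1}$ satisfies a (full) large deviation principle with speed $n^{p/2}$ and good rate function $\mathcal I$. That is, $\mathcal I:\mathbb R\to[0,\infty]$ is lower semicontinuous with compact level sets $\{\mathcal I\le\alpha\}$, $\alpha\in\mathbb R$, and for every Lebesgue measurable $A\subseteq\mathbb R$ with interior $A^\circ$ and closure $\overline A$, $$-\inf_{y\in A^\circ}\mathcal I(y)\le\liminf_{n\to\infty}\frac{\log\mathbb P(Y^{(n)}\in A)}{n^{p/2}}\le\limsup_{n\to\infty}\frac{\log\mathbb P(Y^{(n)}\in A)}{n^{p/2}}\le-\inf_{y\in\overline A}\mathcal I(y),$$ with the conventions $\log 0=-\infty$ and $\inf\emptyset=+\infty$. -/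

import Mathlib

open MeasureTheory ProbabilityTheory Filter Topology
open scoped ENNReal

noncomputable section

namespace RandomProjection

/-! ### Large deviation principles -/

/-- The sequence `Y` of real random variables on `(Ω, P)` satisfies a (full) large deviation
principle with speed `s` and (good) rate function `I : ℝ → [0, ∞]`: `I` is lower semicontinuous
with compact level sets, and for every Lebesgue measurable `A ⊆ ℝ`
`-inf_{A°} I ≤ liminf (1/s(n)) log P(Y n ∈ A) ≤ limsup (1/s(n)) log P(Y n ∈ A) ≤ -inf_{cl A} I`.
All quantities are extended reals; in particular `log 0 = -∞` and the infimum over `∅` is `+∞`. -/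
structure SatisfiesLDP {Ω : Type*} [MeasurableSpace Ω] (P : Measure Ω) (Y : ℕ → Ω → ℝ)
    (s : ℕ → ℝ) (I : ℝ → ℝ≥0∞) : Prop where
  lowerSemicontinuous : LowerSemicontinuous I
  isCompact_levelSet : ∀ α : ℝ, IsCompact {x : ℝ | (I x : EReal) ≤ (α : EReal)}
  lower_bound : ∀ A : Set ℝ, NullMeasurableSet A volume →
    -(⨅ x ∈ interior A, (I x : EReal)) ≤
      liminf (fun n => ENNReal.log (P {ω | Y n ω ∈ A}) / (s n : EReal)) atTop
  upper_bound : ∀ A : Set ℝ, NullMeasurableSet A volume →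
    limsup (fun n => ENNReal.log (P {ω | Y n ω ∈ A}) / (s n : EReal)) atTop ≤
      -(⨅ x ∈ closure A, (I x : EReal))

/-! ### The `ℓ_p`-ball -/

/-- The unit ball `{x ∈ ℝⁿ : (∑ |x_i|^p)^{1/p} ≤ 1}` of `ℓ_pⁿ`, for a finite exponent `p`. -/
def lpBall (n : ℕ) (p : ℝ) : Set (EuclideanSpace ℝ (Fin n)) :=
  {x | (∑ i, |x i| ^ p) ^ (1 / p) ≤ 1}

/-! ### The Grassmannian and its Haar probability measure -/

/-- The Grassmannian of `k`-dimensional linear subspaces of `ℝⁿ`. -/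
def Grassmannian (n k : ℕ) : Type :=
  {E : Submodule ℝ (EuclideanSpace ℝ (Fin n)) // Module.finrank ℝ E = k}

/-- The closed Euclidean unit ball of a linear subspace, as a subset of `ℝⁿ`. -/
def subspaceBall {n : ℕ} (E : Submodule ℝ (EuclideanSpace ℝ (Fin n))) :
    Set (EuclideanSpace ℝ (Fin n)) :=
  (E : Set (EuclideanSpace ℝ (Fin n))) ∩ Metric.closedBall 0 1

/-- `subspaceBall` of an element of the Grassmannian, as a nonempty compact set. -/
def ballCompacts {n k : ℕ} (E : Grassmannian n k) :
    TopologicalSpace.NonemptyCompacts (EuclideanSpace ℝ (Fin n)) where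
  carrier := subspaceBall E.1
  isCompact' := (isCompact_closedBall 0 1).inter_left E.1.closed_of_finiteDimensional
  nonempty' := ⟨0, E.1.zero_mem, by simp⟩

theorem subspaceBall_injective {n : ℕ} :
    Function.Injective (subspaceBall (n := n)) := by
  have key : ∀ E F : Submodule ℝ (EuclideanSpace ℝ (Fin n)),
      subspaceBall E = subspaceBall F → E ≤ F := by
    intro E F h x hx
    by_cases h0 : x = 0
    · simp [h0]
    have hn : ‖x‖ ≠ 0 := norm_ne_zero_iff.mpr h0
    have h1 : ‖x‖⁻¹ • x ∈ subspaceBall E := by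
      refine ⟨E.smul_mem _ hx, ?_⟩
      simp [norm_smul, hn]
    rw [h] at h1
    have h2 := F.smul_mem ‖x‖ h1.1
    rwa [smul_smul, mul_inv_cancel₀ hn, one_smul] at h2
  exact fun E F h => le_antisymm (key E F h) (key F E h.symm)

theorem ballCompacts_injective {n k : ℕ} :
    Function.Injective (ballCompacts (n := n) (k := k)) := by
  intro E F h
  have h' : (ballCompacts E : Set (EuclideanSpace ℝ (Fin n))) = ballCompacts F := by rw [h]
  exact Subtype.ext (subspaceBall_injective h')

/-- The metric on the Grassmannian: the Hausdorff distance of the Euclidean unit balls. -/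
instance (n k : ℕ) : MetricSpace (Grassmannian n k) :=
  MetricSpace.induced ballCompacts ballCompacts_injective inferInstance

theorem Grassmannian.dist_eq {n k : ℕ} (E F : Grassmannian n k) :
    dist E F = Metric.hausdorffDist (subspaceBall E.1) (subspaceBall F.1) := rfl

/-- The Borel `σ`-field on the Grassmannian. -/
instance (n k : ℕ) : MeasurableSpace (Grassmannian n k) := borel _

instance (n k : ℕ) : BorelSpace (Grassmannian n k) := ⟨rfl⟩

/-- The Borel `σ`-field on the orthogonal group. -/
instance (n : ℕ) : MeasurableSpace (Matrix.orthogonalGroup (Fin n) ℝ) := borel _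

instance (n : ℕ) : BorelSpace (Matrix.orthogonalGroup (Fin n) ℝ) := ⟨rfl⟩

instance (n : ℕ) : CompactSpace (Matrix.orthogonalGroup (Fin n) ℝ) := by
  refine isCompact_iff_compactSpace.mp ?_
  have hK : IsCompact (Set.univ.pi fun _ : Fin n => Set.univ.pi fun _ : Fin n =>
      Metric.closedBall (0 : ℝ) 1) :=
    isCompact_univ_pi fun _ => isCompact_univ_pi fun _ => isCompact_closedBall 0 1
  refine IsCompact.of_isClosed_subset (X := Matrix (Fin n) (Fin n) ℝ) hK isClosed_unitary ?_
  intro U hU i _ j _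
  simpa using entry_norm_bound_of_unitary (𝕜 := ℝ) hU i j

/-- The Haar probability measure on the orthogonal group `O(n)`. -/
def orthogonalHaar (n : ℕ) : Measure (Matrix.orthogonalGroup (Fin n) ℝ) :=
  Measure.haarMeasure ⊤

instance (n : ℕ) : IsProbabilityMeasure (orthogonalHaar n) :=
  ⟨Measure.haarMeasure_self⟩

/-- The coordinate subspace `span {e_1, …, e_k}` of `ℝⁿ`. -/
def coordSubspace (n k : ℕ) : Submodule ℝ (EuclideanSpace ℝ (Fin n)) :=
  Submodule.span ℝ ((fun i : Fin n => EuclideanSpace.single i (1 : ℝ)) '' {i | (i : ℕ) < k})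

theorem finrank_coordSubspace {n k : ℕ} (hk : k ≤ n) :
    Module.finrank ℝ (coordSubspace n k) = k := by
  have hli : LinearIndependent ℝ
      (fun i : {i : Fin n // (i : ℕ) < k} => EuclideanSpace.single i.1 (1 : ℝ)) := by
    have h := (EuclideanSpace.basisFun (Fin n) ℝ).toBasis.linearIndependent
    have h' := h.comp (fun i : {i : Fin n // (i : ℕ) < k} => i.1) Subtype.val_injective
    have he : (fun i : {i : Fin n // (i : ℕ) < k} => EuclideanSpace.single i.1 (1 : ℝ)) =
        (EuclideanSpace.basisFun (Fin n) ℝ).toBasis ∘ fun i => i.1 := by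
      ext i : 1
      simp
    rw [he]
    exact h'
  have h := finrank_span_eq_card hli
  have hr : Set.range (fun i : {i : Fin n // (i : ℕ) < k} => EuclideanSpace.single i.1 (1 : ℝ)) =
      (fun i : Fin n => EuclideanSpace.single i (1 : ℝ)) '' {i | (i : ℕ) < k} := by
    ext x; simp
  rw [hr] at h
  rw [coordSubspace, h, Fintype.card_subtype]
  rw [Fin.card_filter_val_lt, min_eq_right hk]

/-- The linear isomorphism of `ℝⁿ` given by an orthogonal matrix. -/
def orthogonalEquiv {n : ℕ} (T : Matrix.orthogonalGroup (Fin n) ℝ) :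
    EuclideanSpace ℝ (Fin n) ≃ₗ[ℝ] EuclideanSpace ℝ (Fin n) :=
  LinearEquiv.ofLinearMap (Matrix.toEuclideanLin T.1) (Matrix.toEuclideanLin (T⁻¹).1)
    (by
      ext1 x
      have h : T.1 * (T⁻¹).1 = 1 := congrArg Subtype.val (mul_inv_cancel T)
      rw [LinearMap.comp_apply, Matrix.toLpLin_apply, Matrix.toLpLin_apply, Matrix.mulVec_mulVec, h,
        Matrix.one_mulVec]
      rfl)
    (by
      ext1 x
      have h : (T⁻¹).1 * T.1 = 1 := congrArg Subtype.val (inv_mul_cancel T)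
      rw [LinearMap.comp_apply, Matrix.toLpLin_apply, Matrix.toLpLin_apply, Matrix.mulVec_mulVec, h,
        Matrix.one_mulVec]
      rfl)

/-- The image `T E₀` of `E₀ = span {e_1, …, e_k}` under an orthogonal matrix `T`. -/
def rotatedCoordSubspace {n k : ℕ} (hk : k ≤ n) (T : Matrix.orthogonalGroup (Fin n) ℝ) :
    Grassmannian n k :=
  ⟨(coordSubspace n k).map (orthogonalEquiv T).toLinearMap, by
    rw [LinearEquiv.finrank_map_eq, finrank_coordSubspace hk]⟩

/-- The Haar probability measure on the Grassmannian: the image of the Haar probability measure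
on `O(n)` under `T ↦ T E₀`. -/
def grassmannianHaar {n k : ℕ} (hk : k ≤ n) : Measure (Grassmannian n k) :=
  (orthogonalHaar n).map (rotatedCoordSubspace hk)

theorem norm_orthogonalEquiv {n : ℕ} (T : Matrix.orthogonalGroup (Fin n) ℝ)
    (x : EuclideanSpace ℝ (Fin n)) : ‖orthogonalEquiv T x‖ = ‖x‖ := by
  have h : inner ℝ (orthogonalEquiv T x) (orthogonalEquiv T x) = inner ℝ x x := by
    change inner ℝ (Matrix.toEuclideanLin T.1 x) (Matrix.toEuclideanLin T.1 x) = _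
    rw [← LinearMap.adjoint_inner_right, ← Matrix.toEuclideanLin_conjTranspose_eq_adjoint]
    have h1 : T.1.conjTranspose * T.1 = 1 := Unitary.star_mul_self_of_mem T.2
    congr 1
    rw [Matrix.toLpLin_apply, Matrix.toLpLin_apply, Matrix.mulVec_mulVec, h1, Matrix.one_mulVec]
  rw [real_inner_self_eq_norm_sq, real_inner_self_eq_norm_sq] at h
  exact (pow_left_inj₀ (norm_nonneg _) (norm_nonneg _) two_ne_zero).mp h

theorem continuous_rotatedCoordSubspace {n k : ℕ} (hk : k ≤ n) :
    Continuous (rotatedCoordSubspace hk) := by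
  let L : Matrix (Fin n) (Fin n) ℝ →ₗ[ℝ]
      (EuclideanSpace ℝ (Fin n) →L[ℝ] EuclideanSpace ℝ (Fin n)) :=
    (Matrix.toEuclideanCLM (n := Fin n) (𝕜 := ℝ)).toAlgEquiv.toLinearMap
  have hL : Continuous L := L.continuous_of_finiteDimensional
  have hLT : ∀ (T : Matrix.orthogonalGroup (Fin n) ℝ) v, L T.1 v = orthogonalEquiv T v :=
    fun T v => rfl
  have one_side : ∀ T S : Matrix.orthogonalGroup (Fin n) ℝ,
      ∀ x ∈ subspaceBall (rotatedCoordSubspace hk T).1,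
        ∃ y ∈ subspaceBall (rotatedCoordSubspace hk S).1, dist x y ≤ ‖L T.1 - L S.1‖ := by
    rintro T S _ ⟨⟨v, hv, rfl⟩, hb⟩
    have hv1 : ‖v‖ ≤ 1 := by
      have : ‖orthogonalEquiv T v‖ ≤ 1 := mem_closedBall_zero_iff.mp hb
      rwa [norm_orthogonalEquiv] at this
    refine ⟨orthogonalEquiv S v, ⟨⟨v, hv, rfl⟩, ?_⟩, ?_⟩
    · rw [mem_closedBall_zero_iff, norm_orthogonalEquiv]
      exact hv1
    · have h := (L T.1 - L S.1).le_of_opNorm_le_of_le le_rfl hv1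
      rw [mul_one] at h
      rw [dist_eq_norm]
      exact h
  have hle : ∀ T S : Matrix.orthogonalGroup (Fin n) ℝ,
      dist (rotatedCoordSubspace hk T) (rotatedCoordSubspace hk S) ≤ ‖L T.1 - L S.1‖ := by
    intro T S
    rw [Grassmannian.dist_eq]
    refine Metric.hausdorffDist_le_of_mem_dist (norm_nonneg _) (one_side T S) ?_
    intro x hx
    obtain ⟨y, hy, hxy⟩ := one_side S T x hx
    exact ⟨y, hy, by rwa [norm_sub_rev] at hxy⟩
  rw [continuous_iff_continuousAt]
  intro S
  rw [ContinuousAt, tendsto_iff_dist_tendsto_zero]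
  refine squeeze_zero (fun _ => dist_nonneg) (fun T => hle T S) ?_
  have hc : Continuous fun T : Matrix.orthogonalGroup (Fin n) ℝ => ‖L T.1 - L S.1‖ :=
    ((hL.comp continuous_subtype_val).sub continuous_const).norm
  simpa using hc.tendsto S

instance {n k : ℕ} (hk : k ≤ n) : IsProbabilityMeasure (grassmannianHaar hk) :=
  Measure.isProbabilityMeasure_map (continuous_rotatedCoordSubspace hk).measurable.aemeasurable

/-! ### The random variables, the constant `m_p` and the rate function -/

/-- The normalized Euclidean norm `n^{1/p - 1/2} ‖P_E x‖₂` of the orthogonal projection of `x`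
onto the subspace `E` of `ℝⁿ`. -/
def normalizedProjNorm (p : ℝ) {n k : ℕ} (E : Grassmannian n k)
    (x : EuclideanSpace ℝ (Fin n)) : ℝ :=
  (n : ℝ) ^ (1 / p - 1 / 2) * ‖E.1.starProjection x‖

/-- The density of a `p`-generalized Gaussian random variable. -/
def genGaussianDensity (p x : ℝ) : ℝ :=
  (2 * p ^ (1 / p) * Real.Gamma (1 + 1 / p))⁻¹ * Real.exp (-|x| ^ p / p)

/-- The law of a `p`-generalized Gaussian random variable. -/
def genGaussian (p : ℝ) : Measure ℝ :=
  volume.withDensity fun x => ENNReal.ofReal (genGaussianDensity p x)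

/-- The constant `m_p = (p^{2/p} / 3) Γ(1 + 3/p) / Γ(1 + 1/p)`. -/
def mConst (p : ℝ) : ℝ :=
  p ^ (2 / p) / 3 * (Real.Gamma (1 + 3 / p) / Real.Gamma (1 + 1 / p))

open Classical in
/-- The rate function `(1/p) (y²/λ - m_p)^{p/2}` for `y ≥ √(λ m_p)`, and `+∞` otherwise. -/
def rateFunction (p lam y : ℝ) : ℝ≥0∞ :=
  if Real.sqrt (lam * mConst p) ≤ y then
    ENNReal.ofReal (1 / p * (y ^ 2 / lam - mConst p) ^ (p / 2))
  else ⊤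

end RandomProjection

end

noncomputable section

namespace RandomProjection

/-! ### One-dimensional generalized Gaussian measures -/

/-! Away from `X = 0`, the square of the variable factors as `n^(2/p-1) ‖P_E X‖₂² = normRatio p X *
(∑ |X_i|^p)^(2/p) * (‖P_E X‖₂² / ‖X‖₂²)`, and only the first factor deviates from its limit at speed
`n^(p/2)`.

The second factor is radial: `‖X‖_p ≤ r` has probability `r^n`, so it tends to 1 with errors
exponentially small in `n`. The third is, by rotation invariance, distributed as the share of the
first `k_n` coordinates in the squared norm of a standard Gaussian vector, so it tends to `λ`, again
with errors exponential in `n`. As `p/2 < 1`, such errors are superexponentially small at speed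
`n^(p/2)`.

The first factor is invariant under dilations, and on cones the uniform law of the ball agrees with
the law of a vector `z` of independent `p`-generalized Gaussians (`uniform_lpBall_cone_eq`). It may
therefore be replaced by `(∑ z_i²/n) * (∑ |z_i|^p/n)^(-2/p)`. Here `|z|^p` has exponential moments,
so its empirical mean also concentrates at 1 at speed `n`. The square `z²` has none: its tail is of
order `exp(-t^(p/2)/p)`. The cheapest way to push the mean of the squares from `m_p` up to `y` is to
make one coordinate satisfy `z_i² ≈ n(y - m_p)`, at cost `(1/p)(n(y - m_p))^(p/2)`; this is the rate
function. Pushing the mean below `m_p` requires many coordinates and costs exponentially in `n`,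
hence the infinite rate there.

The estimates for the squares are `eventually_genGaussian_le_sum_sq_le` (truncated Chernoff bound)
and `eventually_le_genGaussian_sum_sq` (one big jump). `OneSidedLDP.mul` transfers them through
factors that concentrate superexponentially, `OneSidedLDP.of_sq` takes the square root, and
`OneSidedLDP.satisfiesLDP` turns tail bounds into the full principle. -/

theorem measurable_genGaussianDensity (p : ℝ) : Measurable (genGaussianDensity p) := by
  unfold genGaussianDensity
  fun_prop

theorem genGaussianDensity_pos {p : ℝ} (hp : 0 < p) (x : ℝ) : 0 < genGaussianDensity p x := by
  have : 0 < Real.Gamma (1 + 1 / p) := Real.Gamma_pos_of_pos (by positivity)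
  unfold genGaussianDensity
  positivity

theorem integrable_comp_abs_of_integrableOn_Ioi {f : ℝ → ℝ} (hf : IntegrableOn f (Set.Ioi 0)) :
    Integrable (fun x => f |x|) := by
  have h1 : IntegrableOn (fun x => f |x|) (Set.Ioi 0) :=
    hf.congr_fun (fun x hx => by rw [abs_of_pos hx]) measurableSet_Ioi
  have h2 : IntegrableOn (fun x => f |x|) (Set.Iic 0) := by
    rw [integrableOn_Iic_iff_integrableOn_Iio]
    have h3 : IntegrableOn ((fun x => f |x|) ∘ Neg.neg) (Neg.neg ⁻¹' Set.Ioi (0 : ℝ)) :=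
      ((Measure.measurePreserving_neg (volume : Measure ℝ)).integrableOn_comp_preimage
        (Homeomorph.neg ℝ).measurableEmbedding).mpr h1
    simpa [Function.comp_def] using h3
  rw [← integrableOn_univ, ← Set.Iic_union_Ioi (a := (0 : ℝ))]
  exact h2.union h1

theorem integrable_abs_rpow_mul_exp {p b s : ℝ} (hp : 0 < p) (hb : 0 < b) (hs : 0 ≤ s) :
    Integrable (fun x : ℝ => |x| ^ s * Real.exp (-b * |x| ^ p)) :=
  integrable_comp_abs_of_integrableOn_Ioi
    (integrableOn_rpow_mul_exp_neg_mul_rpow (by linarith) hp hb)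

theorem integral_abs_rpow_mul_exp {p b s : ℝ} (hp : 0 < p) (hb : 0 < b) (hs : 0 ≤ s) :
    ∫ x : ℝ, |x| ^ s * Real.exp (-b * |x| ^ p) =
      2 * (b ^ (-(s + 1) / p) * (1 / p) * Real.Gamma ((s + 1) / p)) := by
  rw [← integral_rpow_mul_exp_neg_mul_rpow hp (by linarith) hb]
  exact integral_comp_abs (f := fun x => x ^ s * Real.exp (-b * x ^ p))

theorem integrable_genGaussian_iff {p : ℝ} (hp : 0 < p) {g : ℝ → ℝ} :
    Integrable g (genGaussian p) ↔ Integrable (fun x => genGaussianDensity p x * g x) := by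
  unfold genGaussian
  rw [integrable_withDensity_iff_integrable_smul'
    (measurable_genGaussianDensity p).ennreal_ofReal (by simp)]
  simp [ENNReal.toReal_ofReal (genGaussianDensity_pos hp _).le]

theorem integral_genGaussian {p : ℝ} (hp : 0 < p) (g : ℝ → ℝ) :
    ∫ x, g x ∂(genGaussian p) = ∫ x, genGaussianDensity p x * g x := by
  unfold genGaussian
  rw [integral_withDensity_eq_integral_toReal_smul
    (measurable_genGaussianDensity p).ennreal_ofReal (by simp)]
  simp [ENNReal.toReal_ofReal (genGaussianDensity_pos hp _).le]

/-- Exponential tilting by `a |x|^p` only changes the decay constant from `1/p` to `1/p - a`. The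
case `a = 0` yields the moments, and `a < 1/p` the exponential moments needed for Chernoff bounds.
-/
theorem genGaussianDensity_mul_eq (p a s x : ℝ) :
    genGaussianDensity p x * (|x| ^ s * Real.exp (a * |x| ^ p)) =
      (2 * p ^ (1 / p) * Real.Gamma (1 + 1 / p))⁻¹ *
        (|x| ^ s * Real.exp (-(1 / p - a) * |x| ^ p)) := by
  have : Real.exp (-(1 / p - a) * |x| ^ p) =
      Real.exp (-|x| ^ p / p) * Real.exp (a * |x| ^ p) := by
    rw [← Real.exp_add]; congr 1; ring
  rw [this, genGaussianDensity]
  ring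

theorem integrable_genGaussian_abs_rpow_mul_exp {p a s : ℝ} (hp : 0 < p) (ha : a < 1 / p)
    (hs : 0 ≤ s) :
    Integrable (fun x : ℝ => |x| ^ s * Real.exp (a * |x| ^ p)) (genGaussian p) := by
  rw [integrable_genGaussian_iff hp]
  simp_rw [genGaussianDensity_mul_eq]
  exact (integrable_abs_rpow_mul_exp hp (by linarith) hs).const_mul _

theorem integrable_genGaussian_abs_rpow {p s : ℝ} (hp : 0 < p) (hs : 0 ≤ s) :
    Integrable (fun x : ℝ => |x| ^ s) (genGaussian p) := by
  simpa using integrable_genGaussian_abs_rpow_mul_exp (a := 0) hp (by positivity) hs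

theorem integral_genGaussian_abs_rpow {p s : ℝ} (hp : 0 < p) (hs : 0 ≤ s) :
    ∫ x, |x| ^ s ∂(genGaussian p) =
      p ^ (s / p) * Real.Gamma ((s + 1) / p) / Real.Gamma (1 / p) := by
  have h := fun x => genGaussianDensity_mul_eq p 0 s x
  simp only [zero_mul, Real.exp_zero, mul_one, sub_zero] at h
  rw [integral_genGaussian hp]
  simp_rw [h]
  rw [integral_const_mul, integral_abs_rpow_mul_exp hp (by positivity) hs, add_comm 1 (1 / p),
    Real.Gamma_add_one (by positivity)]
  have h1 : (1 / p) ^ (-(s + 1) / p) = p ^ (s / p) * p ^ (1 / p) := by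
    rw [one_div, Real.inv_rpow hp.le, ← Real.rpow_neg hp.le, ← Real.rpow_add hp]
    congr 1; ring
  rw [h1]
  have hG : Real.Gamma (1 / p) ≠ 0 := (Real.Gamma_pos_of_pos (by positivity)).ne'
  have hpp : p ^ (1 / p) ≠ 0 := (Real.rpow_pos_of_pos hp _).ne'
  field_simp

theorem isProbabilityMeasure_genGaussian {p : ℝ} (hp : 0 < p) :
    IsProbabilityMeasure (genGaussian p) := by
  have h := integral_genGaussian_abs_rpow hp le_rfl
  have hG : Real.Gamma (1 / p) ≠ 0 := (Real.Gamma_pos_of_pos (by positivity)).ne'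
  simp only [Real.rpow_zero, zero_div, zero_add, one_mul, div_self hG, integral_const,
    smul_eq_mul, mul_one] at h
  constructor
  rw [← ENNReal.toReal_eq_one_iff]
  exact h

theorem integrable_genGaussian_sq {p : ℝ} (hp : 0 < p) :
    Integrable (fun z : ℝ => z ^ 2) (genGaussian p) := by
  have h := integrable_genGaussian_abs_rpow hp (s := 2) (by norm_num)
  simpa using h

theorem integral_genGaussian_sq {p : ℝ} (hp : 0 < p) :
    ∫ z, z ^ 2 ∂(genGaussian p) = mConst p := by
  have h := integral_genGaussian_abs_rpow hp (s := 2) (by norm_num)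
  have hG : Real.Gamma (1 / p) ≠ 0 := (Real.Gamma_pos_of_pos (by positivity)).ne'
  simp only [Real.rpow_ofNat, sq_abs] at h
  rw [h, mConst, add_comm 1 (3 / p), add_comm 1 (1 / p), Real.Gamma_add_one (by positivity),
    Real.Gamma_add_one (by positivity)]
  norm_num
  field_simp

theorem integral_genGaussian_abs_rpow_self {p : ℝ} (hp : 0 < p) :
    ∫ z, |z| ^ p ∂(genGaussian p) = 1 := by
  rw [integral_genGaussian_abs_rpow hp hp.le, add_div, div_self hp.ne', add_comm,
    Real.Gamma_add_one (by positivity), Real.rpow_one]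
  have hG : Real.Gamma (1 / p) ≠ 0 := (Real.Gamma_pos_of_pos (by positivity)).ne'
  field_simp

theorem mConst_pos {p : ℝ} (hp : 0 < p) : 0 < mConst p := by
  have h1 : 0 < Real.Gamma (1 + 1 / p) := Real.Gamma_pos_of_pos (by positivity)
  have h2 : 0 < Real.Gamma (1 + 3 / p) := Real.Gamma_pos_of_pos (by positivity)
  unfold mConst
  positivity

/-! ### Generalized Gaussian random vectors -/

theorem lintegral_pi_prod {n : ℕ} (μ : Measure ℝ) [SigmaFinite μ] (f : Fin n → ℝ → ℝ≥0∞)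
    (hf : ∀ i, Measurable (f i)) :
    ∫⁻ x : Fin n → ℝ, ∏ i, f i (x i) ∂(Measure.pi fun _ => μ) = ∏ i, ∫⁻ t, f i t ∂μ := by
  induction n with
  | zero => simp
  | succ n ih =>
    have hmp := measurePreserving_piFinSuccAbove (fun _ : Fin (n + 1) => μ) 0
    rw [← (hmp.symm _).lintegral_comp_emb (MeasurableEquiv.measurableEmbedding _),
      Fin.prod_univ_succ, ← ih _ fun i => hf i.succ,
      ← lintegral_prod_mul (hf 0).aemeasurable (Finset.measurable_prod _ fun i _ =>
        (hf i.succ).comp (measurable_pi_apply i)).aemeasurable]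
    refine lintegral_congr fun z => ?_
    simp [MeasurableEquiv.piFinSuccAbove, Fin.prod_univ_succ]

theorem pi_withDensity {n : ℕ} (μ : Measure ℝ) [SigmaFinite μ] {f : ℝ → ℝ≥0∞}
    (hf : Measurable f) [SigmaFinite (μ.withDensity f)] :
    Measure.pi (fun _ : Fin n => μ.withDensity f) =
      (Measure.pi fun _ => μ).withDensity fun x => ∏ i, f (x i) := by
  refine Measure.pi_eq fun s hs => ?_
  rw [withDensity_apply _ (MeasurableSet.univ_pi hs),
    ← lintegral_indicator (MeasurableSet.univ_pi hs)]
  have : ∀ x : Fin n → ℝ, (Set.univ.pi s).indicator (fun x => ∏ i, f (x i)) x =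
      ∏ i, (s i).indicator f (x i) := by
    intro x
    by_cases hx : x ∈ Set.univ.pi s
    · rw [Set.indicator_of_mem hx]
      exact Finset.prod_congr rfl fun i _ => (Set.indicator_of_mem (hx i trivial) f).symm
    · rw [Set.indicator_of_notMem hx]
      simp only [Set.mem_pi, Set.mem_univ, true_imp_iff, not_forall] at hx
      obtain ⟨i, hi⟩ := hx
      exact (Finset.prod_eq_zero (Finset.mem_univ i) (Set.indicator_of_notMem hi f)).symm
  simp_rw [this]
  rw [lintegral_pi_prod μ _ fun i => hf.indicator (hs i)]
  refine Finset.prod_congr rfl fun i _ => ?_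
  rw [withDensity_apply _ (hs i), lintegral_indicator (hs i)]

/-- The law of a random vector in `ℝⁿ` with independent `p`-generalized Gaussian coordinates. -/
def genGaussianVec (p : ℝ) (n : ℕ) : Measure (EuclideanSpace ℝ (Fin n)) :=
  (Measure.pi fun _ : Fin n => genGaussian p).map (WithLp.toLp 2)

theorem isProbabilityMeasure_genGaussianVec {p : ℝ} (hp : 0 < p) (n : ℕ) :
    IsProbabilityMeasure (genGaussianVec p n) := by
  have := isProbabilityMeasure_genGaussian hp
  exact Measure.isProbabilityMeasure_map (by fun_prop)

theorem genGaussianVec_apply (p : ℝ) {n : ℕ} {A : Set (EuclideanSpace ℝ (Fin n))}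
    (hA : MeasurableSet A) :
    genGaussianVec p n A = (Measure.pi fun _ : Fin n => genGaussian p) (WithLp.toLp 2 ⁻¹' A) :=
  Measure.map_apply (by fun_prop) hA

theorem genGaussianVec_eq_withDensity {p : ℝ} (hp : 0 < p) (n : ℕ) :
    genGaussianVec p n = volume.withDensity fun x => ENNReal.ofReal
      ((2 * p ^ (1 / p) * Real.Gamma (1 + 1 / p))⁻¹ ^ n * Real.exp (-(∑ i, |x i| ^ p) / p)) := by
  have := isProbabilityMeasure_genGaussian hp
  have hprob : IsProbabilityMeasure (volume.withDensity
    fun x => ENNReal.ofReal (genGaussianDensity p x)) := this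
  have hm := (measurable_genGaussianDensity p).ennreal_ofReal
  ext A hA
  rw [genGaussianVec_apply p hA]
  unfold genGaussian
  rw [pi_withDensity volume hm, withDensity_apply _ (hA.preimage (by fun_prop)),
    withDensity_apply _ hA, ← (PiLp.volume_preserving_toLp (Fin n)).setLIntegral_comp_preimage hA
      (by fun_prop), ← volume_pi]
  refine lintegral_congr fun x => ?_
  rw [← ENNReal.ofReal_prod_of_nonneg fun i _ => (genGaussianDensity_pos hp _).le]
  congr 1
  unfold genGaussianDensity
  rw [Finset.prod_mul_distrib, ← Real.exp_sum]
  simp [Finset.sum_div, Finset.sum_neg_distrib, neg_div]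

/-! ### Chernoff bounds for product measures -/

/-- Multiply `1 - u ≤ exp (-u)` by `exp u` and iterate once. The first-order coefficient is kept
exact so that the mean appears exactly in the Chernoff bounds. -/
theorem exp_le_one_add_add_sq_mul_exp {u : ℝ} (hu : 0 ≤ u) :
    Real.exp u ≤ 1 + u + u ^ 2 * Real.exp u := by
  have h1 : Real.exp u - 1 ≤ u * Real.exp u := by
    have h2 := mul_le_mul_of_nonneg_right (Real.add_one_le_exp (-u)) (Real.exp_pos u).le
    rw [← Real.exp_add, neg_add_cancel, Real.exp_zero] at h2
    linarith
  nlinarith [mul_le_mul_of_nonneg_left h1 hu]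

theorem exp_neg_le_one_sub_add_sq {u : ℝ} (hu : 0 ≤ u) : Real.exp (-u) ≤ 1 - u + u ^ 2 := by
  have h1 := Real.quadratic_le_exp_of_nonneg hu
  have h2 : Real.exp (-u) * Real.exp u = 1 := by rw [← Real.exp_add]; simp
  have h3 := Real.exp_pos (-u)
  nlinarith [mul_le_mul_of_nonneg_left h1 h3.le, sq_nonneg (u - 1), pow_nonneg hu 3,
    pow_nonneg hu 4]

theorem pi_real_le_sum_le {n : ℕ} (μ : Measure ℝ) [IsProbabilityMeasure μ] (S : Finset (Fin n))
    {h : ℝ → ℝ} (hint : Integrable (fun t => Real.exp (h t)) μ) (a : ℝ) :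
    (Measure.pi fun _ : Fin n => μ).real {z | a ≤ ∑ i ∈ S, h (z i)} ≤
      Real.exp (-a) * (∫ t, Real.exp (h t) ∂μ) ^ S.card := by
  classical
  set f : Fin n → ℝ → ℝ := fun i t => if i ∈ S then Real.exp (h t) else 1
  have hf : ∀ z : Fin n → ℝ, Real.exp (1 * ∑ i ∈ S, h (z i)) = ∏ i, f i (z i) := by
    intro z
    rw [one_mul, Real.exp_sum, Finset.prod_ite_mem, Finset.univ_inter]
  have hfi : ∀ i, Integrable (f i) μ := by
    intro i
    by_cases hi : i ∈ S
    · simpa [f, hi] using hint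
    · simp [f, hi]
  have hI : Integrable (fun z : Fin n → ℝ => Real.exp (1 * ∑ i ∈ S, h (z i)))
      (Measure.pi fun _ => μ) := by
    simp_rw [hf]
    exact Integrable.fintype_prod hfi
  refine (measure_ge_le_exp_mul_mgf a zero_le_one hI).trans_eq ?_
  rw [mgf]
  simp_rw [hf]
  rw [integral_fintype_prod_eq_prod]
  have : ∀ i, ∫ t, f i t ∂μ = if i ∈ S then ∫ t, Real.exp (h t) ∂μ else 1 := by
    intro i
    by_cases hi : i ∈ S <;> simp [f, hi]
  simp_rw [this]
  rw [Finset.prod_ite_mem, Finset.univ_inter, Finset.prod_const]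
  simp

theorem pi_real_le_sum_le_exp_mul {n : ℕ} (μ : Measure ℝ) [IsProbabilityMeasure μ]
    (S : Finset (Fin n)) {h : ℝ → ℝ} (hint : Integrable (fun t => Real.exp (h t)) μ) {a l : ℝ}
    (hl : ∫ t, Real.exp (h t) ∂μ ≤ 1 + l) :
    (Measure.pi fun _ : Fin n => μ).real {z | a ≤ ∑ i ∈ S, h (z i)} ≤
      Real.exp (-a + S.card * l) := by
  refine (pi_real_le_sum_le μ S hint a).trans ?_
  rw [Real.exp_add, Real.exp_nat_mul]
  gcongr
  linarith [Real.add_one_le_exp l]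

theorem integral_one_add_mul_add_mul (μ : Measure ℝ) [IsProbabilityMeasure μ] {g h : ℝ → ℝ}
    (hg : Integrable g μ) (hh : Integrable h μ) (a b : ℝ) :
    ∫ t, 1 + a * g t + b * h t ∂μ = 1 + (a * ∫ t, g t ∂μ + b * ∫ t, h t ∂μ) := by
  have h1 : Integrable (fun t => 1 + a * g t) μ := (integrable_const 1).add (hg.const_mul a)
  rw [integral_add h1 (hh.const_mul b), integral_add (integrable_const 1) (hg.const_mul a),
    integral_const_mul, integral_const_mul]
  simp [add_assoc]

/-- Chernoff's bound with a small tilt `θ`: the exponential moment is at most `1 + θ·mean + θ² K`,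
and once `θ K ≤ x/2` the quadratic term consumes only half of the gain `θ x`. The constant depends
on neither `n` nor `S`. -/
theorem exists_pi_real_mean_add_le_sum_le (μ : Measure ℝ) [IsProbabilityMeasure μ] {g : ℝ → ℝ}
    (hgm : Measurable g) (hg : ∀ t, 0 ≤ g t) (hgi : Integrable g μ) {t₀ : ℝ} (ht₀ : 0 < t₀)
    (hgt : Integrable (fun t => g t ^ 2 * Real.exp (t₀ * g t)) μ) {x : ℝ} (hx : 0 < x) :
    ∃ c, 0 < c ∧ ∀ (n : ℕ) (S : Finset (Fin n)), (Measure.pi fun _ : Fin n => μ).real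
      {z | S.card * (∫ t, g t ∂μ + x) ≤ ∑ i ∈ S, g (z i)} ≤ Real.exp (-(c * S.card)) := by
  set K := ∫ t, g t ^ 2 * Real.exp (t₀ * g t) ∂μ
  have hK : 0 ≤ K := integral_nonneg fun t => by positivity
  obtain ⟨θ, hθ, hθ₀, hθK⟩ : ∃ θ, 0 < θ ∧ θ ≤ t₀ ∧ θ * K ≤ x / 2 := by
    -- `K + 1` replaces `K` because `K` may vanish.
    refine ⟨min t₀ (x / (2 * (K + 1))), by positivity, min_le_left _ _, ?_⟩
    calc _ ≤ x / (2 * (K + 1)) * K := by gcongr; exact min_le_right _ _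
      _ ≤ x / (2 * (K + 1)) * (K + 1) := by gcongr; linarith
      _ = x / 2 := by field_simp
  have hle : ∀ t, Real.exp (θ * g t) ≤ 1 + θ * g t + θ ^ 2 * (g t ^ 2 * Real.exp (t₀ * g t)) := by
    intro t
    have h0 := hg t
    refine (exp_le_one_add_add_sq_mul_exp (by positivity)).trans ?_
    rw [mul_pow, mul_assoc]
    gcongr
  have hdom : Integrable
      (fun t => 1 + θ * g t + θ ^ 2 * (g t ^ 2 * Real.exp (t₀ * g t))) μ :=
    ((integrable_const 1).add (hgi.const_mul θ)).add (hgt.const_mul _)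
  have hint : Integrable (fun t => Real.exp (θ * g t)) μ :=
    hdom.mono' (by fun_prop) (.of_forall fun t => by
      rw [Real.norm_of_nonneg (Real.exp_pos _).le]; exact hle t)
  have hval : ∫ t, Real.exp (θ * g t) ∂μ ≤ 1 + (θ * ∫ t, g t ∂μ + θ ^ 2 * K) := by
    rw [← integral_one_add_mul_add_mul μ hgi hgt]
    exact integral_mono hint hdom hle
  refine ⟨θ * x / 2, by positivity, fun n S => ?_⟩
  have h := pi_real_le_sum_le_exp_mul μ S hint (a := θ * (S.card * (∫ t, g t ∂μ + x))) hval
  simp_rw [← Finset.mul_sum, mul_le_mul_iff_right₀ hθ] at h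
  refine h.trans (Real.exp_le_exp.mpr ?_)
  have h1 : (S.card : ℝ) * θ * (θ * K) ≤ S.card * θ * (x / 2) := by gcongr
  linarith

/-- For nonnegative summands `exp (-θ g)` is bounded, so a second moment suffices on this side. This
is why the lower tail of the squares stays exponential in `n` even though their upper tail is not.
-/
theorem exists_pi_real_sum_le_mean_sub_le (μ : Measure ℝ) [IsProbabilityMeasure μ] {g : ℝ → ℝ}
    (hgm : Measurable g) (hg : ∀ t, 0 ≤ g t) (hgi : Integrable g μ)
    (hgt : Integrable (fun t => g t ^ 2) μ) {x : ℝ} (hx : 0 < x) :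
    ∃ c, 0 < c ∧ ∀ (n : ℕ) (S : Finset (Fin n)), (Measure.pi fun _ : Fin n => μ).real
      {z | ∑ i ∈ S, g (z i) ≤ S.card * (∫ t, g t ∂μ - x)} ≤ Real.exp (-(c * S.card)) := by
  set K := ∫ t, g t ^ 2 ∂μ
  have hK : 0 ≤ K := integral_nonneg fun t => by positivity
  obtain ⟨θ, hθ, hθK⟩ : ∃ θ, 0 < θ ∧ θ * K ≤ x / 2 := by
    refine ⟨x / (2 * (K + 1)), by positivity, ?_⟩
    calc _ ≤ x / (2 * (K + 1)) * (K + 1) := by gcongr; linarith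
      _ = x / 2 := by field_simp
  have hle : ∀ t, Real.exp (-(θ * g t)) ≤ 1 - θ * g t + θ ^ 2 * g t ^ 2 := by
    intro t
    have h0 := hg t
    rw [← mul_pow]
    exact exp_neg_le_one_sub_add_sq (by positivity)
  have hdom : Integrable (fun t => 1 - θ * g t + θ ^ 2 * g t ^ 2) μ :=
    ((integrable_const 1).sub (hgi.const_mul θ)).add (hgt.const_mul _)
  have hint : Integrable (fun t => Real.exp (-(θ * g t))) μ :=
    hdom.mono' (by fun_prop) (.of_forall fun t => by
      rw [Real.norm_of_nonneg (Real.exp_pos _).le]; exact hle t)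
  have hval : ∫ t, Real.exp (-(θ * g t)) ∂μ ≤ 1 + (-(θ * ∫ t, g t ∂μ) + θ ^ 2 * K) := by
    have h := integral_one_add_mul_add_mul μ hgi hgt (-θ) (θ ^ 2)
    simp_rw [neg_mul, ← sub_eq_add_neg] at h
    refine (integral_mono hint hdom hle).trans_eq (h.trans ?_)
    ring
  refine ⟨θ * x / 2, by positivity, fun n S => ?_⟩
  have h := pi_real_le_sum_le_exp_mul μ S hint (a := -(θ * (S.card * (∫ t, g t ∂μ - x)))) hval
  simp_rw [Finset.sum_neg_distrib, neg_le_neg_iff, ← Finset.mul_sum,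
    mul_le_mul_iff_right₀ hθ] at h
  refine h.trans (Real.exp_le_exp.mpr ?_)
  have h1 : (S.card : ℝ) * θ * (θ * K) ≤ S.card * θ * (x / 2) := by gcongr
  linarith

/-! ### Exponential concentration of empirical moments -/

theorem exists_genGaussian_abs_rpow_concentration {p : ℝ} (hp : 0 < p) {x : ℝ} (hx : 0 < x) :
    ∃ c, 0 < c ∧ ∀ (n : ℕ) (S : Finset (Fin n)), (Measure.pi fun _ : Fin n => genGaussian p).real
      {z | S.card * x ≤ |∑ i ∈ S, |z i| ^ p - S.card|} ≤ 2 * Real.exp (-(c * S.card)) := by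
  have := isProbabilityMeasure_genGaussian hp
  have hm : Measurable fun z : ℝ => |z| ^ p := by fun_prop
  have hi := integrable_genGaussian_abs_rpow hp hp.le
  have hsq : ∀ z : ℝ, (|z| ^ p) ^ 2 = |z| ^ (2 * p) := fun z => by
    rw [← Real.rpow_natCast, ← Real.rpow_mul (abs_nonneg z)]; congr 1; push_cast; ring
  have h0 : ∀ z : ℝ, 0 ≤ |z| ^ p := fun z => by positivity
  -- Any tilt strictly between 0 and `1/p` would do; half of `1/p` is taken.
  obtain ⟨c, hc, h⟩ := exists_pi_real_mean_add_le_sum_le (genGaussian p) hm h0 hi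
    (t₀ := 1 / (2 * p)) (by positivity) (by
      simp_rw [hsq]
      exact integrable_genGaussian_abs_rpow_mul_exp hp (by gcongr; linarith) (by positivity)) hx
  obtain ⟨c', hc', h'⟩ := exists_pi_real_sum_le_mean_sub_le (genGaussian p) hm h0 hi
    (by
      simp_rw [hsq]
      exact integrable_genGaussian_abs_rpow hp (by positivity)) hx
  refine ⟨min c c', lt_min hc hc', fun n S => ?_⟩
  rw [integral_genGaussian_abs_rpow_self hp] at h h'
  have hsub : {z : Fin n → ℝ | S.card * x ≤ |∑ i ∈ S, |z i| ^ p - S.card|} ⊆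
      {z | S.card * (1 + x) ≤ ∑ i ∈ S, |z i| ^ p} ∪
        {z | ∑ i ∈ S, |z i| ^ p ≤ S.card * (1 - x)} := by
    intro z hz
    rcases le_abs.mp (Set.mem_ofPred.mp hz) with hz | hz
    · left; simp only [Set.mem_ofPred_eq]; linarith
    · right; simp only [Set.mem_ofPred_eq]; linarith
  have e1 : Real.exp (-(c * S.card)) ≤ Real.exp (-(min c c' * S.card)) := by
    gcongr; exact min_le_left _ _
  have e2 : Real.exp (-(c' * S.card)) ≤ Real.exp (-(min c c' * S.card)) := by
    gcongr; exact min_le_right _ _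
  calc _ ≤ _ := measureReal_mono hsub
    _ ≤ _ := measureReal_union_le _ _
    _ ≤ _ := add_le_add ((h n S).trans e1) ((h' n S).trans e2)
    _ = _ := by ring

theorem exists_genGaussian_sum_sq_le {p : ℝ} (hp : 0 < p) {x : ℝ} (hx : 0 < x) :
    ∃ c, 0 < c ∧ ∀ n : ℕ, (Measure.pi fun _ : Fin n => genGaussian p).real
      {z | ∑ i, z i ^ 2 ≤ n * (mConst p - x)} ≤ Real.exp (-(c * n)) := by
  have := isProbabilityMeasure_genGaussian hp
  obtain ⟨c, hc, h⟩ := exists_pi_real_sum_le_mean_sub_le (genGaussian p)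
    (g := fun z => z ^ 2) (by fun_prop) (fun z => sq_nonneg z) (integrable_genGaussian_sq hp)
    (by
      have h4 := integrable_genGaussian_abs_rpow hp (s := 4) (by norm_num)
      refine h4.congr (.of_forall fun z => ?_)
      simp only [Real.rpow_ofNat]
      rw [← pow_mul, Even.pow_abs (by decide)]) hx
  refine ⟨c, hc, fun n => ?_⟩
  rw [integral_genGaussian_sq hp] at h
  simpa using h n Finset.univ

/-! ### Stretched exponential asymptotics -/

theorem tendsto_natCast_rpow_atTop {q : ℝ} (hq : 0 < q) :
    Tendsto (fun n : ℕ => (n : ℝ) ^ q) atTop atTop :=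
  (tendsto_rpow_atTop hq).comp tendsto_natCast_atTop_atTop

theorem eventually_mul_rpow_le_mul_rpow {r q : ℝ} (hrq : r < q) (C : ℝ) {ε : ℝ} (hε : 0 < ε) :
    ∀ᶠ n : ℕ in atTop, C * (n : ℝ) ^ r ≤ ε * (n : ℝ) ^ q := by
  filter_upwards [(tendsto_natCast_rpow_atTop (sub_pos.mpr hrq)).eventually_ge_atTop (C / ε),
    eventually_gt_atTop 0] with n hn hn0
  have hn0' : (0 : ℝ) < n := by exact_mod_cast hn0
  rw [div_le_iff₀ hε] at hn
  calc C * (n : ℝ) ^ r ≤ (n : ℝ) ^ (q - r) * ε * (n : ℝ) ^ r := by gcongr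
    _ = ε * ((n : ℝ) ^ (q - r) * (n : ℝ) ^ r) := by ring
    _ = ε * (n : ℝ) ^ q := by rw [← Real.rpow_add hn0']; congr 2; ring

theorem eventually_exp_mul_exp_le {r q : ℝ} (hrq : r < q) (K : ℝ) {b b' : ℝ} (hb : b < b') :
    ∀ᶠ n : ℕ in atTop, Real.exp (K * (n : ℝ) ^ r) * Real.exp (-(b' * (n : ℝ) ^ q)) ≤
      Real.exp (-(b * (n : ℝ) ^ q)) := by
  filter_upwards [eventually_mul_rpow_le_mul_rpow hrq K (sub_pos.mpr hb)] with n hn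
  rw [← Real.exp_add]
  apply Real.exp_le_exp.mpr
  linarith

theorem eventually_const_mul_exp_le {q : ℝ} (hq : 0 < q) (C : ℝ) {b b' : ℝ} (hb : b < b') :
    ∀ᶠ n : ℕ in atTop, C * Real.exp (-(b' * (n : ℝ) ^ q)) ≤
      Real.exp (-(b * (n : ℝ) ^ q)) := by
  filter_upwards [eventually_exp_mul_exp_le hq C hb] with n hn
  refine le_trans ?_ hn
  gcongr
  rw [Real.rpow_zero, mul_one]
  linarith [Real.add_one_le_exp C]

theorem eventually_natCast_mul_exp_le {q : ℝ} (hq : 0 < q) {b b' : ℝ} (hb : b < b') :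
    ∀ᶠ n : ℕ in atTop, (n : ℝ) * Real.exp (-(b' * (n : ℝ) ^ q)) ≤
      Real.exp (-(b * (n : ℝ) ^ q)) := by
  filter_upwards [eventually_exp_mul_exp_le (half_lt_self hq) (q / 2)⁻¹ hb,
    eventually_gt_atTop 0] with n hn hn0
  refine le_trans ?_ hn
  gcongr
  have h1 : Real.log n ≤ (n : ℝ) ^ (q / 2) / (q / 2) :=
    Real.log_le_rpow_div (by positivity) (by positivity)
  rw [← Real.log_le_iff_le_exp (by exact_mod_cast hn0)]
  rwa [inv_mul_eq_div]

theorem eventually_mul_exp_neg_le {q : ℝ} (hq1 : q < 1) (C : ℝ) {c : ℝ} (hc : 0 < c)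
    (b : ℝ) :
    ∀ᶠ n : ℕ in atTop, C * Real.exp (-(c * n)) ≤ Real.exp (-(b * (n : ℝ) ^ q)) := by
  filter_upwards [eventually_mul_rpow_le_mul_rpow hq1 b (half_pos hc),
    eventually_const_mul_exp_le one_pos C (half_lt_self hc)] with n hn hn'
  rw [Real.rpow_one] at hn hn'
  exact hn'.trans (Real.exp_le_exp.mpr (by linarith))

/-! ### Large deviations of the empirical second moment -/

/-- Truncation at level `M`. Either some coordinate has `z_i² > M`, which the union bound and
Markov's inequality for `exp (a |z|^p)` control, or all squares are at most `M`. In that case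
Chernoff's bound applies to the truncated squares, and `C`, `K` are moments that do not depend on
`M`. -/
theorem exists_genGaussian_le_sum_sq_le {p : ℝ} (hp : 0 < p) (hp2 : p < 2) {a : ℝ} (ha : 0 < a)
    (hap : a < 1 / p) :
    ∃ C K : ℝ, 0 ≤ C ∧ 0 ≤ K ∧ ∀ (n : ℕ) (M A : ℝ), 0 < M →
      (Measure.pi fun _ : Fin n => genGaussian p).real {z | A ≤ ∑ i, z i ^ 2} ≤
        n * (C * Real.exp (-(a * M ^ (p / 2)))) +
          Real.exp (-(a * M ^ (p / 2 - 1) * A) +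
            n * (a * M ^ (p / 2 - 1) * mConst p + (a * M ^ (p / 2 - 1)) ^ 2 * K)) := by
  have := isProbabilityMeasure_genGaussian hp
  have hexp : Integrable (fun z : ℝ => Real.exp (a * |z| ^ p)) (genGaussian p) := by
    simpa using integrable_genGaussian_abs_rpow_mul_exp (s := 0) hp hap le_rfl
  have hexp4 : Integrable (fun z : ℝ => z ^ 4 * Real.exp (a * |z| ^ p)) (genGaussian p) := by
    have h := integrable_genGaussian_abs_rpow_mul_exp (s := 4) hp hap (by norm_num)
    simpa [Even.pow_abs (show Even 4 by decide)] using h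
  have hsqi := integrable_genGaussian_sq hp
  refine ⟨∫ z, Real.exp (a * |z| ^ p) ∂(genGaussian p),
    ∫ z, z ^ 4 * Real.exp (a * |z| ^ p) ∂(genGaussian p),
    integral_nonneg fun _ => (Real.exp_pos _).le, integral_nonneg fun _ => by positivity,
    fun n M A hM => ?_⟩
  -- The largest tilt with `θ z² ≤ a |z|^p` for all `z² ≤ M`: as `p/2 - 1 < 0`, the ratio `|z|^p /
  -- z² = (z²)^(p/2-1)` is smallest at `z² = M`.
  set θ := a * M ^ (p / 2 - 1)
  have hθ : 0 < θ := by positivity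
  have hsq : ∀ z : ℝ, (z ^ 2) ^ (p / 2) = |z| ^ p := fun z => by
    rw [← sq_abs, ← Real.rpow_natCast, ← Real.rpow_mul (abs_nonneg z)]; congr 1; push_cast; ring
  have hle : ∀ z : ℝ, z ^ 2 ≤ M → θ * z ^ 2 ≤ a * |z| ^ p := by
    intro z hz
    rcases eq_or_ne z 0 with rfl | hz0
    · simp [hp.ne']
    have hz2 : 0 < z ^ 2 := by positivity
    rw [mul_assoc]
    gcongr
    calc M ^ (p / 2 - 1) * z ^ 2 ≤ (z ^ 2) ^ (p / 2 - 1) * (z ^ 2) := by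
          gcongr ?_ * _
          exact Real.rpow_le_rpow_of_nonpos hz2 hz (by linarith)
      _ = |z| ^ p := by
          rw [← hsq z]
          conv_lhs => rw [← Real.rpow_add_one hz2.ne']
          congr 1; ring
  set h : ℝ → ℝ := fun z => if z ^ 2 ≤ M then θ * z ^ 2 else 0
  have hhm : Measurable h :=
    Measurable.ite (measurableSet_le (by fun_prop) (by fun_prop)) (by fun_prop) (by fun_prop)
  have hexph : ∀ z, Real.exp (h z) ≤
      1 + θ * z ^ 2 + θ ^ 2 * (z ^ 4 * Real.exp (a * |z| ^ p)) := by
    intro z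
    by_cases hz : z ^ 2 ≤ M
    · simp only [h, if_pos hz]
      refine (exp_le_one_add_add_sq_mul_exp (by positivity)).trans ?_
      rw [show (θ * z ^ 2) ^ 2 = θ ^ 2 * z ^ 4 by ring, mul_assoc (θ ^ 2)]
      have := Real.exp_le_exp.mpr (hle z hz)
      gcongr
    · simp only [h, if_neg hz, Real.exp_zero, add_assoc]
      exact le_add_of_nonneg_right (by positivity)
  have hdom : Integrable (fun z => 1 + θ * z ^ 2 + θ ^ 2 * (z ^ 4 * Real.exp (a * |z| ^ p)))
      (genGaussian p) :=
    ((integrable_const 1).add (hsqi.const_mul θ)).add (hexp4.const_mul _)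
  have hint : Integrable (fun z => Real.exp (h z)) (genGaussian p) :=
    hdom.mono' (by fun_prop) (.of_forall fun t => by
      rw [Real.norm_of_nonneg (Real.exp_pos _).le]; exact hexph t)
  have hval := (integral_mono hint hdom hexph).trans_eq
    (integral_one_add_mul_add_mul _ hsqi hexp4 θ (θ ^ 2))
  rw [integral_genGaussian_sq hp] at hval
  have hsub : {z : Fin n → ℝ | A ≤ ∑ i, z i ^ 2} ⊆
      (⋃ i, {z | a * M ^ (p / 2) ≤ ∑ j ∈ {i}, a * |z j| ^ p}) ∪
        {z | θ * A ≤ ∑ i, h (z i)} := by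
    intro z hz
    by_cases hall : ∀ i, z i ^ 2 ≤ M
    · right
      simp only [h, Set.mem_ofPred_eq, hall, if_true, ← Finset.mul_sum]
      gcongr
      exact hz
    · left
      push Not at hall
      obtain ⟨i, hi⟩ := hall
      refine Set.mem_iUnion.mpr ⟨i, ?_⟩
      simp only [Set.mem_ofPred_eq, Finset.sum_singleton]
      rw [← hsq]
      gcongr
  refine (measureReal_mono hsub).trans ((measureReal_union_le _ _).trans (add_le_add ?_ ?_))
  · refine (measureReal_iUnion_fintype_le _).trans ?_
    refine (Finset.sum_le_sum fun i _ => pi_real_le_sum_le (genGaussian p) {i} hexp _).trans_eq ?_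
    simp [mul_comm]
  · simpa using pi_real_le_sum_le_exp_mul (genGaussian p) Finset.univ hint (a := θ * A) hval

/-- With truncation level `M = n x` both terms have leading exponent `-a (n x)^(p/2)`. The quadratic
correction is of order `n^(p-1)`, negligible because `p - 1 < p/2`, and `a` may be taken arbitrarily
close to `1/p`. -/
theorem eventually_genGaussian_le_sum_sq_le {p : ℝ} (hp : 0 < p) (hp2 : p < 2) {x b : ℝ}
    (hx : 0 < x) (hb : b < 1 / p * x ^ (p / 2)) :
    ∀ᶠ n : ℕ in atTop, (Measure.pi fun _ : Fin n => genGaussian p).real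
      {z | n * (mConst p + x) ≤ ∑ i, z i ^ 2} ≤ Real.exp (-(b * (n : ℝ) ^ (p / 2))) := by
  have hxq : 0 < x ^ (p / 2) := by positivity
  obtain ⟨a, ha0, ha, hab⟩ : ∃ a, 0 < a ∧ a < 1 / p ∧ b < a * x ^ (p / 2) := by
    have h1 : max 0 (b / x ^ (p / 2)) < 1 / p :=
      max_lt (by positivity) (by rwa [div_lt_iff₀ hxq])
    obtain ⟨a, h2, h3⟩ := exists_between h1
    exact ⟨a, (le_max_left _ _).trans_lt h2, h3,
      by rw [← div_lt_iff₀ hxq]; exact (le_max_right _ _).trans_lt h2⟩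
  obtain ⟨C, K, hC, hK, h⟩ := exists_genGaussian_le_sum_sq_le hp hp2 ha0 ha
  -- The gaps between `b < b₁ < b₂ < b₃ < a x^(p/2)` absorb, one at a time, the factors `n`, `C`,
  -- `exp (const · n^(p-1))` and the final 2 from adding two terms.
  obtain ⟨b₁, hb₁, hb₁'⟩ := exists_between hab
  obtain ⟨b₂, hb₂, hb₂'⟩ := exists_between hb₁'
  obtain ⟨b₃, hb₃, hb₃'⟩ := exists_between hb₂'
  have hq : 0 < p / 2 := by positivity
  filter_upwards [eventually_gt_atTop 0, eventually_natCast_mul_exp_le hq hb₃',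
    eventually_const_mul_exp_le hq C hb₃,
    eventually_exp_mul_exp_le (show 2 * (p / 2) - 1 < p / 2 by linarith)
      ((a * x ^ (p / 2 - 1)) ^ 2 * K) hb₂',
    eventually_const_mul_exp_le hq 2 hb₁, eventually_const_mul_exp_le hq 1 hb₂]
    with n hn0 h1 h2 h3 h4 h5
  have hn : (0 : ℝ) < n := by exact_mod_cast hn0
  refine (h n (n * x) (n * (mConst p + x)) (by positivity)).trans ?_
  have e1 : a * (n * x) ^ (p / 2) = a * x ^ (p / 2) * (n : ℝ) ^ (p / 2) := by
    rw [Real.mul_rpow hn.le hx.le]; ring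
  have e2 : a * (n * x : ℝ) ^ (p / 2 - 1) * (n * x) = a * x ^ (p / 2) * (n : ℝ) ^ (p / 2) := by
    rw [← e1, mul_assoc]
    conv_lhs => rw [← Real.rpow_add_one (by positivity : (n * x : ℝ) ≠ 0)]
    congr 2; ring
  have e3 : n * ((a * (n * x : ℝ) ^ (p / 2 - 1)) ^ 2 * K) =
      (a * x ^ (p / 2 - 1)) ^ 2 * K * (n : ℝ) ^ (2 * (p / 2) - 1) := by
    have : (n : ℝ) ^ (2 * (p / 2) - 1) = ((n : ℝ) ^ (p / 2 - 1)) ^ 2 * n := by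
      rw [← Real.rpow_natCast, ← Real.rpow_mul hn.le, ← Real.rpow_add_one hn.ne']
      congr 1; push_cast; ring
    rw [this, Real.mul_rpow hn.le hx.le]; ring
  have e4 : -(a * (n * x : ℝ) ^ (p / 2 - 1) * (n * (mConst p + x))) +
      n * (a * (n * x : ℝ) ^ (p / 2 - 1) * mConst p + (a * (n * x : ℝ) ^ (p / 2 - 1)) ^ 2 * K) =
      (a * x ^ (p / 2 - 1)) ^ 2 * K * (n : ℝ) ^ (2 * (p / 2) - 1) +
        -(a * x ^ (p / 2) * (n : ℝ) ^ (p / 2)) := by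
    rw [← e3, ← e2]; ring
  rw [e4, e1, Real.exp_add]
  have f1 : n * (C * Real.exp (-(a * x ^ (p / 2) * (n : ℝ) ^ (p / 2)))) ≤
      Real.exp (-(b₁ * (n : ℝ) ^ (p / 2))) := by
    calc _ = C * (n * Real.exp (-(a * x ^ (p / 2) * (n : ℝ) ^ (p / 2)))) := by ring
      _ ≤ C * Real.exp (-(b₃ * (n : ℝ) ^ (p / 2))) := by gcongr
      _ ≤ Real.exp (-(b₂ * (n : ℝ) ^ (p / 2))) := h2
      _ ≤ _ := by simpa using h5
  have f2 := h3.trans ((one_mul _).symm.le.trans h5)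
  linarith

/-- The density decreases on the positive half-line, so on the interval it is at least its value at
the right end. -/
theorem le_genGaussian_real_Ioo {p : ℝ} (hp : 0 < p) {u v : ℝ} (hu : 0 ≤ u) :
    (2 * p ^ (1 / p) * Real.Gamma (1 + 1 / p))⁻¹ * (v - u) * Real.exp (-(1 / p * v ^ p)) ≤
      (genGaussian p).real (Set.Ioo u v) := by
  have := isProbabilityMeasure_genGaussian hp
  rcases le_or_gt v u with h | huv
  · refine le_trans ?_ measureReal_nonneg
    have : 0 < Real.Gamma (1 + 1 / p) := Real.Gamma_pos_of_pos (by positivity)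
    refine mul_nonpos_of_nonpos_of_nonneg (mul_nonpos_of_nonneg_of_nonpos (by positivity)
      (by linarith)) (Real.exp_pos _).le
  rw [measureReal_def, ← ENNReal.ofReal_le_iff_le_toReal (measure_ne_top _ _), genGaussian,
    withDensity_apply _ measurableSet_Ioo]
  calc _ = ∫⁻ _ in Set.Ioo u v, ENNReal.ofReal (genGaussianDensity p v) := by
        rw [setLIntegral_const, Real.volume_Ioo,
          ← ENNReal.ofReal_mul (genGaussianDensity_pos hp v).le]
        congr 1
        rw [genGaussianDensity, abs_of_nonneg (hu.trans huv.le), neg_div, div_eq_inv_mul (v ^ p),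
          one_div]
        ring
    _ ≤ _ := by
        refine setLIntegral_mono (measurable_genGaussianDensity p).ennreal_ofReal fun x hx => ?_
        apply ENNReal.ofReal_le_ofReal
        have hx0 : 0 < x := hu.trans_lt hx.1
        have : 0 < Real.Gamma (1 + 1 / p) := Real.Gamma_pos_of_pos (by positivity)
        unfold genGaussianDensity
        rw [abs_of_pos hx0, abs_of_pos (hx0.trans hx.2)]
        gcongr
        exact hx.2.le

theorem eventually_half_le_genGaussian_sum_sq_near {p : ℝ} (hp : 0 < p) (hp2 : p < 2) {δ : ℝ}
    (hδ : 0 < δ) :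
    ∀ᶠ n : ℕ in atTop, 1 / 2 ≤ (Measure.pi fun _ : Fin n => genGaussian p).real
      {z | n * (mConst p - δ) < ∑ i, z i ^ 2 ∧ ∑ i, z i ^ 2 < n * (mConst p + δ)} := by
  have := isProbabilityMeasure_genGaussian hp
  obtain ⟨c, hc, h⟩ := exists_genGaussian_sum_sq_le hp hδ
  have hq : 0 < p / 2 := by positivity
  have hd : 0 < 1 / p * δ ^ (p / 2) := by positivity
  -- The factors 4 make each of the two tails at most `1/4`; exponent 0 turns the right-hand sides
  -- of the asymptotic bounds into 1.
  filter_upwards [eventually_genGaussian_le_sum_sq_le hp hp2 hδ (half_lt_self hd),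
    eventually_const_mul_exp_le hq 4 (half_pos hd),
    eventually_mul_exp_neg_le (q := 0) one_pos 4 hc 0] with n h1 h2 h3
  simp only [zero_mul, neg_zero, Real.exp_zero] at h2 h3
  set D := {z : Fin n → ℝ | n * (mConst p - δ) < ∑ i, z i ^ 2 ∧
    ∑ i, z i ^ 2 < n * (mConst p + δ)}
  have hsm : Measurable fun z : Fin n → ℝ => ∑ i, z i ^ 2 := by fun_prop
  have hD : MeasurableSet D :=
    (measurableSet_lt measurable_const hsm).inter (measurableSet_lt hsm measurable_const)
  have hsub : Dᶜ ⊆ {z | ∑ i, z i ^ 2 ≤ n * (mConst p - δ)} ∪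
      {z | n * (mConst p + δ) ≤ ∑ i, z i ^ 2} := by
    intro z hz
    by_contra hcon
    simp only [Set.mem_union, Set.mem_ofPred_eq, not_or, not_le] at hcon
    exact hz hcon
  have h4 := (measureReal_mono hsub).trans ((measureReal_union_le _ _).trans
    (add_le_add (h n) h1))
  rw [measureReal_compl hD, probReal_univ] at h4
  linarith

/-- One big jump: coordinate 0 has its square between `n(a+2δ)` and `n(a+4δ)`, while the other `n -
1` coordinates are typical, which has probability at least `1/2`. By independence the cost is that
of the single coordinate. -/
theorem eventually_le_genGaussian_sum_sq {p : ℝ} (hp : 0 < p) (hp2 : p < 2) {a η b : ℝ}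
    (ha : 0 ≤ a) (hη : 0 < η) (hb : 1 / p * a ^ (p / 2) < b) :
    ∀ᶠ n : ℕ in atTop, Real.exp (-(b * (n : ℝ) ^ (p / 2))) ≤
      (Measure.pi fun _ : Fin n => genGaussian p).real
        {z | n * (mConst p + a) < ∑ i, z i ^ 2 ∧ ∑ i, z i ^ 2 < n * (mConst p + a + η)} := by
  have := isProbabilityMeasure_genGaussian hp
  have hq : 0 < p / 2 := by positivity
  obtain ⟨δ, hδ, hδη, hδb⟩ : ∃ δ, 0 < δ ∧ 8 * δ < η ∧ 1 / p * (a + 4 * δ) ^ (p / 2) < b := by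
    have hcont : ContinuousAt (fun δ : ℝ => 1 / p * (a + 4 * δ) ^ (p / 2)) 0 :=
      ContinuousAt.mul continuousAt_const
        (ContinuousAt.rpow_const (by fun_prop) (Or.inr hq.le))
    have h1 : ∀ᶠ δ in 𝓝 (0 : ℝ), 1 / p * (a + 4 * δ) ^ (p / 2) < b :=
      hcont.eventually_lt_const (by simpa using hb)
    have h2 : ∀ᶠ δ in 𝓝[>] (0 : ℝ), 8 * δ < η := by
      filter_upwards [Ioo_mem_nhdsGT (show (0 : ℝ) < η / 8 by positivity)] with δ hδ
      linarith [hδ.2]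
    obtain ⟨δ, h3, h4, h5⟩ :=
      ((eventually_mem_nhdsWithin.and (h2.and (h1.filter_mono nhdsWithin_le_nhds)))).exists
    exact ⟨δ, h3, h4, h5⟩
  have hG : 0 < Real.Gamma (1 + 1 / p) := Real.Gamma_pos_of_pos (by positivity)
  set c := (2 * p ^ (1 / p) * Real.Gamma (1 + 1 / p))⁻¹
  have hc : 0 < c := by positivity
  set d := √(a + 4 * δ) - √(a + 2 * δ)
  have hd : 0 < d := sub_pos.mpr (Real.sqrt_lt_sqrt (by positivity) (by linarith))
  -- Write `n = k + 1` to split off coordinate 0. The condition `k ≥ m_p/δ` below makes up for the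
  -- other coordinates averaging over `k` rather than `n`.
  rw [← Filter.map_add_atTop_eq_nat 1, Filter.eventually_map]
  filter_upwards [eventually_half_le_genGaussian_sum_sq_near hp hp2 hδ,
    (tendsto_add_atTop_nat 1).eventually (eventually_const_mul_exp_le hq (2 / (c * d)) hδb),
    (tendsto_natCast_atTop_atTop (R := ℝ)).eventually_ge_atTop (mConst p / δ)] with k h1 h2 h3
  rw [div_le_iff₀ hδ] at h3
  set n : ℝ := ((k + 1 : ℕ) : ℝ)
  have hnk : n = k + 1 := by simp [n]
  have hn1 : 1 ≤ n := by rw [hnk]; linarith [(Nat.cast_nonneg k : (0 : ℝ) ≤ k)]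
  set u := √(n * (a + 2 * δ))
  set v := √(n * (a + 4 * δ))
  have huv : d ≤ v - u := by
    simp only [u, v, Real.sqrt_mul (zero_le_one.trans hn1)]
    rw [← mul_sub]
    exact le_mul_of_one_le_left hd.le (by rwa [Real.one_le_sqrt])
  have hvp : v ^ p = (a + 4 * δ) ^ (p / 2) * n ^ (p / 2) := by
    simp only [v]
    rw [Real.sqrt_eq_rpow, ← Real.rpow_mul (by positivity), mul_comm n,
      ← Real.mul_rpow (by positivity) (by positivity)]
    congr 1; ring
  have h5 := le_genGaussian_real_Ioo hp (u := u) (v := v) (Real.sqrt_nonneg _)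
  have h6 : c * d * Real.exp (-(1 / p * (a + 4 * δ) ^ (p / 2) * n ^ (p / 2))) ≤
      (genGaussian p).real (Set.Ioo u v) := by
    refine le_trans ?_ h5
    rw [hvp, ← mul_assoc (1 / p)]
    gcongr
  have hmp := measurePreserving_piFinSuccAbove (fun _ : Fin (k + 1) => genGaussian p) 0
  set D := {z : Fin k → ℝ | k * (mConst p - δ) < ∑ i, z i ^ 2 ∧
    ∑ i, z i ^ 2 < k * (mConst p + δ)}
  have h7 : (Measure.pi fun _ : Fin (k + 1) => genGaussian p).real
      (MeasurableEquiv.piFinSuccAbove (fun _ => ℝ) 0 ⁻¹' (Set.Ioo u v ×ˢ D)) =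
      (genGaussian p).real (Set.Ioo u v) *
        (Measure.pi fun _ : Fin k => genGaussian p).real D := by
    rw [measureReal_def, hmp.measure_preimage_equiv, Measure.prod_prod, ENNReal.toReal_mul]
    rfl
  have hsub : (MeasurableEquiv.piFinSuccAbove (fun _ => ℝ) 0 ⁻¹' (Set.Ioo u v ×ˢ D)) ⊆
      {z : Fin (k + 1) → ℝ | n * (mConst p + a) < ∑ i, z i ^ 2 ∧
        ∑ i, z i ^ 2 < n * (mConst p + a + η)} := by
    rintro z ⟨⟨hz1, hz2⟩, hz3, hz4⟩
    simp only [MeasurableEquiv.piFinSuccAbove_apply, Fin.insertNthEquiv_symm_apply,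
      Fin.removeNth_zero, Fin.tail_def] at hz1 hz2 hz3 hz4
    have hz0 : 0 < z 0 := (Real.sqrt_nonneg _).trans_lt hz1
    have hz1' := (Real.sqrt_lt' hz0).mp hz1
    have hz2' := (Real.lt_sqrt hz0.le).mp hz2
    have hk0 : (0 : ℝ) ≤ k := Nat.cast_nonneg k
    have hm := mConst_pos hp
    simp only [Set.mem_ofPred_eq, Fin.sum_univ_succ]
    rw [hnk] at hz1' hz2' ⊢
    constructor
    · nlinarith
    · nlinarith
  refine le_trans ?_ (measureReal_mono hsub)
  rw [h7]
  calc Real.exp (-(b * n ^ (p / 2))) = c * d * (1 / 2) *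
        (2 / (c * d) * Real.exp (-(b * n ^ (p / 2)))) := by field_simp
    _ ≤ c * d * (1 / 2) * Real.exp (-(1 / p * (a + 4 * δ) ^ (p / 2) * n ^ (p / 2))) := by
        gcongr
    _ = (c * d * Real.exp (-(1 / p * (a + 4 * δ) ^ (p / 2) * n ^ (p / 2)))) * (1 / 2) := by ring
    _ ≤ _ := by gcongr

/-! ### The cone measure of the `ℓ_p`-ball -/

theorem lpBall_eq {p : ℝ} (hp : 0 < p) (n : ℕ) : lpBall n p = {x | ∑ i, |x i| ^ p ≤ 1} := by
  ext x
  have h0 : 0 ≤ ∑ i, |x i| ^ p := Finset.sum_nonneg fun i _ => by positivity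
  simp only [lpBall, Set.mem_ofPred_eq]
  have h := Real.rpow_le_rpow_iff (z := 1 / p) h0 zero_le_one (by positivity)
  rwa [Real.one_rpow] at h

theorem sum_abs_smul_rpow {p : ℝ} {n : ℕ} {r : ℝ} (hr : 0 ≤ r) (x : EuclideanSpace ℝ (Fin n)) :
    ∑ i, |(r • x) i| ^ p = r ^ p * ∑ i, |x i| ^ p := by
  rw [Finset.mul_sum]
  refine Finset.sum_congr rfl fun i _ => ?_
  rw [PiLp.smul_apply, smul_eq_mul, abs_mul, abs_of_nonneg hr, Real.mul_rpow hr (abs_nonneg _)]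

theorem measurable_sum_abs_rpow (p : ℝ) (n : ℕ) :
    Measurable fun x : EuclideanSpace ℝ (Fin n) => ∑ i, |x i| ^ p := by
  fun_prop

theorem measurableSet_lpBall {p : ℝ} (hp : 0 < p) (n : ℕ) : MeasurableSet (lpBall n p) := by
  rw [lpBall_eq hp]
  exact measurableSet_le (measurable_sum_abs_rpow p n) measurable_const

/-- Invariance of a set under multiplication by positive scalars. -/
def IsCone {n : ℕ} (C : Set (EuclideanSpace ℝ (Fin n))) : Prop :=
  ∀ r : ℝ, 0 < r → ∀ x ∈ C, r • x ∈ C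

open scoped Pointwise in
theorem volume_cone_inter_sum_le {p : ℝ} (hp : 0 < p) {n : ℕ}
    {C : Set (EuclideanSpace ℝ (Fin n))} (hC : IsCone C) {r : ℝ} (hr : 0 < r) :
    volume (C ∩ {x | ∑ i, |x i| ^ p ≤ r ^ p}) =
      ENNReal.ofReal (r ^ n) * volume (C ∩ lpBall n p) := by
  have h : C ∩ {x | ∑ i, |x i| ^ p ≤ r ^ p} = r • (C ∩ lpBall n p) := by
    ext x
    rw [Set.mem_smul_set_iff_inv_smul_mem₀ hr.ne', lpBall_eq hp]
    refine and_congr ⟨hC _ (inv_pos.mpr hr) x, fun h => ?_⟩ ?_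
    · simpa [smul_smul, hr.ne'] using hC r hr _ h
    · simp only [Set.mem_ofPred_eq]
      rw [sum_abs_smul_rpow (inv_pos.mpr hr).le, Real.inv_rpow hr.le,
        inv_mul_le_iff₀ (by positivity), mul_one]
  rw [h, Measure.addHaar_smul, finrank_euclideanSpace_fin, abs_of_pos (by positivity)]

theorem lintegral_indicator_Ici_exp_neg {t : ℝ} (ht : 0 ≤ t) :
    ∫⁻ s in Set.Ioi 0, (Set.Ici t).indicator (fun s => ENNReal.ofReal (Real.exp (-s))) s =
      ENNReal.ofReal (Real.exp (-t)) := by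
  rw [lintegral_indicator measurableSet_Ici, Measure.restrict_restrict measurableSet_Ici,
    ← integral_exp_neg_Ioi, ofReal_integral_eq_lintegral_ofReal (integrableOn_exp_neg_Ioi t)
      (.of_forall fun s => (Real.exp_pos _).le)]
  refine setLIntegral_congr ?_
  rcases ht.eq_or_lt with rfl | ht
  · rw [Set.inter_eq_self_of_subset_right Set.Ioi_subset_Ici_self]
    exact ae_eq_refl _
  · rw [Set.inter_eq_self_of_subset_left]
    · exact Ioi_ae_eq_Ici.symm
    · exact fun s hs => ht.trans_le hs

/-- The density is a function of `∑ |x_i|^p` alone. Writing `exp (-t)` as the integral of `exp (-s)`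
over `s ≥ t` and exchanging integrals, each level `s` contributes the volume of a dilate of `C ∩
lpBall n p`, and the dilation factor does not depend on `C`. -/
theorem exists_genGaussianVec_cone_eq {p : ℝ} (hp : 0 < p) (n : ℕ) :
    ∃ κ : ℝ≥0∞, ∀ C : Set (EuclideanSpace ℝ (Fin n)), MeasurableSet C → IsCone C →
      genGaussianVec p n C = κ * volume (C ∩ lpBall n p) := by
  have hG : 0 < Real.Gamma (1 + 1 / p) := Real.Gamma_pos_of_pos (by positivity)
  have hdens := genGaussianVec_eq_withDensity hp n
  set c := (2 * p ^ (1 / p) * Real.Gamma (1 + 1 / p))⁻¹ ^ n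
  have hc : 0 ≤ c := by positivity
  refine ⟨ENNReal.ofReal c * ∫⁻ s in Set.Ioi (0 : ℝ), ENNReal.ofReal (Real.exp (-s)) *
    ENNReal.ofReal (((p * s) ^ (1 / p)) ^ n), fun C hCm hC => ?_⟩
  have hm := measurable_sum_abs_rpow p n
  have hmeas : Measurable fun z : EuclideanSpace ℝ (Fin n) × ℝ =>
      (Set.Ici ((∑ i, |z.1 i| ^ p) / p)).indicator
        (fun s => ENNReal.ofReal (Real.exp (-s))) z.2 := by
    have hset : MeasurableSet {z : EuclideanSpace ℝ (Fin n) × ℝ |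
        (∑ i, |z.1 i| ^ p) / p ≤ z.2} :=
      measurableSet_le ((hm.comp measurable_fst).div_const p) measurable_snd
    exact Measurable.indicator
      (f := fun z : EuclideanSpace ℝ (Fin n) × ℝ => ENNReal.ofReal (Real.exp (-z.2)))
      (by fun_prop) hset
  rw [hdens, withDensity_apply _ hCm]
  simp_rw [ENNReal.ofReal_mul hc]
  rw [lintegral_const_mul _ (by fun_prop), mul_assoc]
  congr 1
  have h1 : ∀ x : EuclideanSpace ℝ (Fin n),
      ENNReal.ofReal (Real.exp (-(∑ i, |x i| ^ p) / p)) =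
        ∫⁻ s in Set.Ioi (0 : ℝ), (Set.Ici ((∑ i, |x i| ^ p) / p)).indicator
          (fun s => ENNReal.ofReal (Real.exp (-s))) s := by
    intro x
    have h0 : 0 ≤ ∑ i, |x i| ^ p := Finset.sum_nonneg fun i _ => by positivity
    rw [lintegral_indicator_Ici_exp_neg (by positivity), neg_div]
  simp_rw [h1]
  rw [lintegral_lintegral_swap hmeas.aemeasurable, ← lintegral_mul_const _ (by fun_prop)]
  refine setLIntegral_congr_fun measurableSet_Ioi fun s hs => ?_
  have hs : 0 < s := hs
  have hps : ((p * s) ^ (1 / p)) ^ p = p * s := by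
    rw [← Real.rpow_mul (by positivity), one_div_mul_cancel hp.ne', Real.rpow_one]
  have h2 := volume_cone_inter_sum_le hp hC (r := (p * s) ^ (1 / p)) (by positivity)
  rw [hps] at h2
  rw [mul_assoc, ← h2, Set.inter_comm, ← Measure.restrict_apply' hCm,
    ← lintegral_indicator_const (measurableSet_le hm measurable_const)]
  refine lintegral_congr fun x => ?_
  simp only [Set.indicator, Set.mem_Ici, Set.mem_ofPred_eq, div_le_iff₀ hp, mul_comm s p]

/-- Testing the proportionality on the whole space identifies `κ` as the inverse volume of the ball.
-/
theorem uniform_lpBall_cone_eq {p : ℝ} (hp : 0 < p) {n : ℕ}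
    {C : Set (EuclideanSpace ℝ (Fin n))} (hCm : MeasurableSet C) (hC : IsCone C) :
    ProbabilityTheory.cond volume (lpBall n p) C = genGaussianVec p n C := by
  obtain ⟨κ, hκ⟩ := exists_genGaussianVec_cone_eq hp n
  have := isProbabilityMeasure_genGaussianVec hp n
  have h1 := hκ Set.univ MeasurableSet.univ fun _ _ _ _ => trivial
  rw [measure_univ, Set.univ_inter] at h1
  rw [cond_apply (measurableSet_lpBall hp n), hκ C hCm hC, Set.inter_comm,
    ← ENNReal.eq_inv_of_mul_eq_one_left h1.symm]

theorem volume_lpBall_ne_zero {p : ℝ} (hp : 0 < p) (n : ℕ) : volume (lpBall n p) ≠ 0 := by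
  obtain ⟨κ, hκ⟩ := exists_genGaussianVec_cone_eq hp n
  have := isProbabilityMeasure_genGaussianVec hp n
  have h1 := hκ Set.univ MeasurableSet.univ fun _ _ _ _ => trivial
  rw [measure_univ, Set.univ_inter] at h1
  rintro h0
  simp [h0] at h1

theorem volume_lpBall_ne_top {p : ℝ} (hp : 0 < p) (n : ℕ) : volume (lpBall n p) ≠ ⊤ := by
  obtain ⟨κ, hκ⟩ := exists_genGaussianVec_cone_eq hp n
  have := isProbabilityMeasure_genGaussianVec hp n
  have h1 := hκ Set.univ MeasurableSet.univ fun _ _ _ _ => trivial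
  rw [measure_univ, Set.univ_inter] at h1
  rintro h0
  rcases eq_or_ne κ 0 with h | h <;> simp [h0, h] at h1

theorem uniform_lpBall_sum_le {p : ℝ} (hp : 0 < p) {n : ℕ} {r : ℝ} (hr : 0 < r) (hr1 : r ≤ 1) :
    ProbabilityTheory.cond volume (lpBall n p) {x | ∑ i, |x i| ^ p ≤ r ^ p} =
      ENNReal.ofReal (r ^ n) := by
  have h := volume_cone_inter_sum_le hp (n := n) (C := Set.univ) (fun _ _ _ _ => trivial) hr
  rw [Set.univ_inter, Set.univ_inter] at h
  have hsub : {x : EuclideanSpace ℝ (Fin n) | ∑ i, |x i| ^ p ≤ r ^ p} ⊆ lpBall n p := by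
    intro x hx
    rw [lpBall_eq hp]
    exact le_trans hx (Real.rpow_le_one hr.le hr1 hp.le)
  rw [cond_apply (measurableSet_lpBall hp n), Set.inter_eq_self_of_subset_right hsub, h,
    mul_comm, mul_assoc, ENNReal.mul_inv_cancel (volume_lpBall_ne_zero hp n)
      (volume_lpBall_ne_top hp n), mul_one]

/-! ### Projections onto random subspaces -/

/-- The squared norm of the first `k` coordinates relative to the squared norm. -/
def coordRatio {n : ℕ} (k : ℕ) (x : EuclideanSpace ℝ (Fin n)) : ℝ :=
  (∑ i : Fin n with i.val < k, x i ^ 2) / ∑ i, x i ^ 2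

theorem measurable_coordRatio {n : ℕ} (k : ℕ) :
    Measurable (coordRatio k : EuclideanSpace ℝ (Fin n) → ℝ) := by
  unfold coordRatio
  fun_prop

theorem coordRatio_smul {n : ℕ} (k : ℕ) {r : ℝ} (hr : r ≠ 0) (x : EuclideanSpace ℝ (Fin n)) :
    coordRatio k (r • x) = coordRatio k x := by
  simp only [coordRatio, PiLp.smul_apply, smul_eq_mul, mul_pow, ← Finset.mul_sum]
  exact mul_div_mul_left _ _ (pow_ne_zero 2 hr)

theorem norm_starProjection_coordSubspace_sq {n : ℕ} (k : ℕ) (x : EuclideanSpace ℝ (Fin n)) :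
    ‖(coordSubspace n k).starProjection x‖ ^ 2 = ∑ i : Fin n with i.val < k, x i ^ 2 := by
  set v : EuclideanSpace ℝ (Fin n) := WithLp.toLp 2 fun i => if i.val < k then x i else 0
  have hv : v = ∑ i : Fin n with i.val < k, x i • EuclideanSpace.single i (1 : ℝ) := by
    ext j
    simp [v, Finset.sum_apply, Pi.single_apply]
  have hvm : v ∈ coordSubspace n k := by
    rw [hv]
    refine Submodule.sum_mem _ fun i hi => Submodule.smul_mem _ _ (Submodule.subset_span ?_)
    exact ⟨i, (Finset.mem_filter.mp hi).2, rfl⟩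
  have hvo : ∀ w ∈ coordSubspace n k, inner ℝ (x - v) w = 0 := by
    intro w hw
    induction hw using Submodule.span_induction with
    | mem w hw =>
      obtain ⟨i, hi, rfl⟩ := hw
      have hi : i.val < k := hi
      rw [EuclideanSpace.inner_single_right]
      simp [v, hi]
    | zero => simp
    | add u w _ _ hu hw => rw [inner_add_right, hu, hw, add_zero]
    | smul a w _ hw => rw [inner_smul_right, hw, mul_zero]
  rw [Submodule.eq_starProjection_of_mem_of_inner_eq_zero hvm hvo, EuclideanSpace.norm_sq_eq,
    Finset.sum_filter]
  refine Finset.sum_congr rfl fun i _ => ?_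
  by_cases hi : i.val < k <;> simp [v, hi]

/-- The linear isometry of `ℝⁿ` given by an orthogonal matrix. -/
def orthogonalIsometry {n : ℕ} (T : Matrix.orthogonalGroup (Fin n) ℝ) :
    EuclideanSpace ℝ (Fin n) ≃ₗᵢ[ℝ] EuclideanSpace ℝ (Fin n) :=
  ⟨orthogonalEquiv T, norm_orthogonalEquiv T⟩

theorem orthogonalIsometry_apply {n : ℕ} (T : Matrix.orthogonalGroup (Fin n) ℝ)
    (x : EuclideanSpace ℝ (Fin n)) :
    orthogonalIsometry T x = Matrix.toEuclideanLin T.1 x := rfl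

theorem orthogonalIsometry_symm_apply {n : ℕ} (T : Matrix.orthogonalGroup (Fin n) ℝ)
    (x : EuclideanSpace ℝ (Fin n)) :
    (orthogonalIsometry T).symm x = orthogonalIsometry T⁻¹ x := rfl

theorem orthogonalIsometry_mul_apply {n : ℕ} (S T : Matrix.orthogonalGroup (Fin n) ℝ)
    (x : EuclideanSpace ℝ (Fin n)) :
    orthogonalIsometry (S * T) x = orthogonalIsometry S (orthogonalIsometry T x) := by
  simp only [orthogonalIsometry_apply]
  rw [Matrix.toLpLin_apply, Matrix.toLpLin_apply, Matrix.toLpLin_apply, Matrix.mulVec_mulVec]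
  rfl

theorem exists_orthogonalIsometry_eq {n : ℕ}
    (f : EuclideanSpace ℝ (Fin n) ≃ₗᵢ[ℝ] EuclideanSpace ℝ (Fin n)) :
    ∃ T : Matrix.orthogonalGroup (Fin n) ℝ, ∀ x, orthogonalIsometry T x = f x := by
  set u := Unitary.linearIsometryEquiv.symm f
  let φ := (Matrix.toEuclideanCLM (n := Fin n) (𝕜 := ℝ)).symm
  have hstar : ∀ a, φ (star a) = star (φ a) := φ.map_star'
  have hmul : ∀ a b, φ (a * b) = φ a * φ b := φ.map_mul'
  have hone : φ 1 = 1 := map_one φ.toAlgEquiv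
  have hmem : φ u.1 ∈ Matrix.orthogonalGroup (Fin n) ℝ := by
    refine Unitary.mem_iff.mpr ⟨?_, ?_⟩
    · rw [← hstar, ← hmul, Unitary.star_mul_self_of_mem u.2, hone]
    · rw [← hstar, ← hmul, Unitary.mul_star_self_of_mem u.2, hone]
  refine ⟨⟨_, hmem⟩, fun x => ?_⟩
  have h : Matrix.toEuclideanCLM (n := Fin n) (𝕜 := ℝ) (φ u.1) = u.1 :=
    StarAlgEquiv.apply_symm_apply _ _
  exact congrArg (fun L : EuclideanSpace ℝ (Fin n) →L[ℝ] EuclideanSpace ℝ (Fin n) => L x) h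

theorem exists_smul_orthogonalIsometry_eq {n : ℕ} {x y : EuclideanSpace ℝ (Fin n)}
    (hx : x ≠ 0) (hy : y ≠ 0) :
    ∃ (r : ℝ) (T : Matrix.orthogonalGroup (Fin n) ℝ), r ≠ 0 ∧ y = r • orthogonalIsometry T x := by
  have hx' : ‖x‖ ≠ 0 := norm_ne_zero_iff.mpr hx
  have hy' : ‖y‖ ≠ 0 := norm_ne_zero_iff.mpr hy
  have hr : ‖y‖ / ‖x‖ ≠ 0 := div_ne_zero hy' hx'
  set z := (‖y‖ / ‖x‖)⁻¹ • y
  have hz : ‖x‖ = ‖z‖ := by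
    rw [norm_smul, norm_inv, norm_div, norm_norm, norm_norm]
    field_simp
  -- After rescaling `y` to the length of `x`, the reflection in the hyperplane orthogonal to `x -
  -- z` maps `x` to `z`.
  obtain ⟨T, hT⟩ := exists_orthogonalIsometry_eq (Submodule.reflection (ℝ ∙ (x - z))ᗮ)
  refine ⟨‖y‖ / ‖x‖, T, hr, ?_⟩
  rw [hT, Submodule.reflection_sub hz, smul_smul, mul_inv_cancel₀ hr, one_smul]

theorem norm_starProjection_rotatedCoordSubspace_sq {n k : ℕ} (hk : k ≤ n)
    (T : Matrix.orthogonalGroup (Fin n) ℝ) (x : EuclideanSpace ℝ (Fin n)) :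
    ‖(rotatedCoordSubspace hk T).1.starProjection x‖ ^ 2 / ‖x‖ ^ 2 =
      coordRatio k (orthogonalIsometry T⁻¹ x) := by
  have h : (rotatedCoordSubspace hk T).1.starProjection x =
      orthogonalIsometry T ((coordSubspace n k).starProjection (orthogonalIsometry T⁻¹ x)) := by
    rw [← orthogonalIsometry_symm_apply]
    exact Submodule.starProjection_map_apply (orthogonalIsometry T) _ x
  rw [h, LinearIsometryEquiv.norm_map, norm_starProjection_coordSubspace_sq, coordRatio,
    ← (orthogonalIsometry T⁻¹).norm_map x, EuclideanSpace.norm_sq_eq]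
  simp

/-- `‖P_E x‖` is the supremum of `⟨x, v⟩` over the unit ball of `E`, so moving the ball by a
Hausdorff distance `d` changes it by at most `‖x‖ d`. The resulting continuity in `E` gives joint
measurability in `x` and `E`. -/
theorem norm_starProjection_le_add_norm_mul_dist {n k : ℕ} (E F : Grassmannian n k)
    (x : EuclideanSpace ℝ (Fin n)) :
    ‖E.1.starProjection x‖ ≤ ‖F.1.starProjection x‖ + ‖x‖ * dist E F := by
  rcases eq_or_ne (E.1.starProjection x) 0 with h0 | h0
  · rw [h0, norm_zero]; positivity
  have hn : 0 < ‖E.1.starProjection x‖ := norm_pos_iff.mpr h0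
  refine le_of_forall_pos_lt_add fun ε hε => ?_
  set r := ε / (‖x‖ + 1)
  have hr : 0 < r := by positivity
  set v := ‖E.1.starProjection x‖⁻¹ • E.1.starProjection x
  have hvE : v ∈ E.1 := E.1.smul_mem _ (Submodule.starProjection_apply_mem _ x)
  have hv1 : ‖v‖ = 1 := by simp [v, norm_smul, hn.ne']
  have hv : v ∈ subspaceBall E.1 := ⟨hvE, by simp [hv1]⟩
  have hfin : Metric.hausdorffEDist (subspaceBall E.1) (subspaceBall F.1) ≠ ⊤ :=
    Metric.hausdorffEDist_ne_top_of_nonempty_of_bounded (ballCompacts E).nonempty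
      (ballCompacts F).nonempty (ballCompacts E).isCompact.isBounded
      (ballCompacts F).isCompact.isBounded
  obtain ⟨w, ⟨hwF, hw1⟩, hvw⟩ := Metric.exists_dist_lt_of_hausdorffDist_lt hv
    (show Metric.hausdorffDist (subspaceBall E.1) (subspaceBall F.1) < dist E F + r by
      rw [← Grassmannian.dist_eq]; linarith) hfin
  have hin : ∀ G : Submodule ℝ (EuclideanSpace ℝ (Fin n)), ∀ u ∈ G,
      inner ℝ x u = inner ℝ (G.starProjection x) u := by
    intro G u hu
    rw [← sub_eq_zero, ← inner_sub_left]
    exact Submodule.starProjection_inner_eq_zero x u hu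
  have h1 : inner ℝ x v = ‖E.1.starProjection x‖ := by
    rw [hin E.1 v hvE, inner_smul_right, real_inner_self_eq_norm_sq]
    field_simp
  have h2 : inner ℝ x w ≤ ‖F.1.starProjection x‖ := by
    rw [hin F.1 w hwF]
    refine (real_inner_le_norm _ _).trans (mul_le_of_le_one_right (norm_nonneg _) ?_)
    simpa using hw1
  have h3 : inner ℝ x (v - w) ≤ ‖x‖ * (dist E F + r) := by
    refine (real_inner_le_norm _ _).trans ?_
    gcongr
    rw [← dist_eq_norm]
    exact hvw.le
  have h4 : ‖x‖ * r < ε := by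
    rw [← mul_div_assoc, div_lt_iff₀ (by positivity)]
    linarith
  rw [inner_sub_right] at h3
  linarith

theorem continuous_norm_starProjection {n k : ℕ} (x : EuclideanSpace ℝ (Fin n)) :
    Continuous fun E : Grassmannian n k => ‖E.1.starProjection x‖ := by
  refine (LipschitzWith.of_le_add_mul ⟨‖x‖, norm_nonneg x⟩ fun E F => ?_).continuous
  exact norm_starProjection_le_add_norm_mul_dist E F x

theorem measurable_norm_starProjection (n k : ℕ) :
    Measurable fun z : EuclideanSpace ℝ (Fin n) × Grassmannian n k => ‖z.2.1.starProjection z.1‖ :=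
  measurable_uncurry_of_continuous_of_measurable
    (u := fun (x : EuclideanSpace ℝ (Fin n)) (E : Grassmannian n k) => ‖E.1.starProjection x‖)
    (fun _ => (ContinuousLinearMap.continuous _).norm)
    (fun x => (continuous_norm_starProjection x).measurable)

theorem measurable_orthogonalIsometry_inv (n : ℕ) :
    Measurable fun z : Matrix.orthogonalGroup (Fin n) ℝ × EuclideanSpace ℝ (Fin n) =>
      orthogonalIsometry z.1⁻¹ z.2 := by
  have hc : Continuous fun z : Matrix.orthogonalGroup (Fin n) ℝ × EuclideanSpace ℝ (Fin n) =>
      orthogonalIsometry z.1⁻¹ z.2 := by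
    simp only [orthogonalIsometry_apply, Matrix.toLpLin_apply]
    refine (PiLp.continuous_toLp 2 _).comp (Continuous.matrix_mulVec ?_ ?_)
    · exact continuous_subtype_val.comp (continuous_inv.comp continuous_fst)
    · exact (PiLp.continuous_ofLp 2 _).comp continuous_snd
  exact hc.measurable

theorem measurePreserving_genGaussianVec_two {n : ℕ}
    (f : EuclideanSpace ℝ (Fin n) ≃ₗᵢ[ℝ] EuclideanSpace ℝ (Fin n)) :
    MeasurePreserving f (genGaussianVec 2 n) (genGaussianVec 2 n) := by
  refine ⟨f.continuous.measurable, ?_⟩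
  ext A hA
  rw [Measure.map_apply f.continuous.measurable hA, genGaussianVec_eq_withDensity two_pos,
    withDensity_apply _ (hA.preimage f.continuous.measurable), withDensity_apply _ hA,
    ← f.measurePreserving.setLIntegral_comp_preimage hA (by fun_prop)]
  refine lintegral_congr fun x => ?_
  have h : ∀ y : EuclideanSpace ℝ (Fin n), ∑ i, |y i| ^ (2 : ℝ) = ‖y‖ ^ 2 := fun y => by
    simp [EuclideanSpace.norm_sq_eq]
  rw [h, h, f.norm_map]

instance instIsMulLeftInvariantOrthogonalHaar (n : ℕ) :
    (orthogonalHaar n).IsMulLeftInvariant := by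
  unfold orthogonalHaar
  infer_instance

theorem genGaussianVec_singleton_zero {p : ℝ} (hp : 0 < p) {n : ℕ} (hn : 1 ≤ n) :
    genGaussianVec p n {0} = 0 := by
  have : Nonempty (Fin n) := ⟨⟨0, hn⟩⟩
  rw [genGaussianVec_eq_withDensity hp]
  exact withDensity_absolutelyContinuous _ _ (measure_singleton 0)

/-- Fubini on the product of Haar and Gaussian measure. For fixed nonzero vector the Haar
probability does not depend on that vector, by transitivity up to scaling and left invariance; for
fixed `T` the Gaussian probability does not depend on `T`, by rotation invariance. Both constants
equal the product probability. -/
theorem orthogonalHaar_coordRatio_mem {n k : ℕ} (hn : 1 ≤ n) {A : Set ℝ}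
    (hA : MeasurableSet A) {x : EuclideanSpace ℝ (Fin n)} (hx : x ≠ 0) :
    orthogonalHaar n {T | coordRatio k (orthogonalIsometry T⁻¹ x) ∈ A} =
      genGaussianVec 2 n {g | coordRatio k g ∈ A} := by
  have := isProbabilityMeasure_genGaussianVec two_pos n
  have hconst : ∀ y : EuclideanSpace ℝ (Fin n), y ≠ 0 →
      orthogonalHaar n {T | coordRatio k (orthogonalIsometry T⁻¹ y) ∈ A} =
        orthogonalHaar n {T | coordRatio k (orthogonalIsometry T⁻¹ x) ∈ A} := by
    intro y hy
    obtain ⟨r, S, hr, rfl⟩ := exists_smul_orthogonalIsometry_eq hx hy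
    rw [← measure_preimage_mul (orthogonalHaar n) S⁻¹
      {T | coordRatio k (orthogonalIsometry T⁻¹ x) ∈ A}]
    congr 1
    ext T
    simp only [Set.mem_ofPred_eq, Set.mem_preimage, map_smul, coordRatio_smul k hr, mul_inv_rev,
      inv_inv, orthogonalIsometry_mul_apply]
  have hset : MeasurableSet {z : Matrix.orthogonalGroup (Fin n) ℝ × EuclideanSpace ℝ (Fin n) |
      coordRatio k (orthogonalIsometry z.1⁻¹ z.2) ∈ A} :=
    ((measurable_coordRatio k).comp (measurable_orthogonalIsometry_inv n)) hA
  have h1 := Measure.prod_apply (μ := orthogonalHaar n) (ν := genGaussianVec 2 n) hset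
  have h2 := Measure.prod_apply_symm (μ := orthogonalHaar n) (ν := genGaussianVec 2 n) hset
  have h3 : ∀ T : Matrix.orthogonalGroup (Fin n) ℝ, genGaussianVec 2 n (Prod.mk T ⁻¹'
      {z | coordRatio k (orthogonalIsometry z.1⁻¹ z.2) ∈ A}) =
        genGaussianVec 2 n {g | coordRatio k g ∈ A} := fun T =>
    (measurePreserving_genGaussianVec_two (orthogonalIsometry T⁻¹)).measure_preimage
      (measurable_coordRatio k hA).nullMeasurableSet
  have hae : ∀ᵐ y ∂(genGaussianVec 2 n), y ≠ 0 := by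
    rw [ae_iff]
    simpa using genGaussianVec_singleton_zero two_pos hn
  simp_rw [h3] at h1
  have h4 := h2.trans (lintegral_congr_ae (g := fun _ => orthogonalHaar n
    {T | coordRatio k (orthogonalIsometry T⁻¹ x) ∈ A})
    (hae.mono fun y hy => hconst y hy))
  rw [h1] at h4
  simpa using h4.symm

theorem grassmannianHaar_norm_sq_mem {n k : ℕ} (hk : k ≤ n) (hn : 1 ≤ n) {A : Set ℝ}
    (hA : MeasurableSet A) {x : EuclideanSpace ℝ (Fin n)} (hx : x ≠ 0) :
    grassmannianHaar hk {E | ‖E.1.starProjection x‖ ^ 2 / ‖x‖ ^ 2 ∈ A} =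
      genGaussianVec 2 n {g | coordRatio k g ∈ A} := by
  rw [← orthogonalHaar_coordRatio_mem hn hA hx, grassmannianHaar]
  refine (Measure.map_apply (continuous_rotatedCoordSubspace hk).measurable
    ((((continuous_norm_starProjection x).measurable.pow_const 2).div_const _) hA)).trans ?_
  congr 1
  ext T
  exact iff_of_eq (congrArg (· ∈ A) (norm_starProjection_rotatedCoordSubspace_sq hk T x))

/-- The law of the relative squared length of the projection of an independent random vector onto
a Haar distributed random subspace. -/
theorem prob_norm_starProjection_sq_mem {Ω : Type*} [MeasurableSpace Ω] {P : Measure Ω}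
    [IsProbabilityMeasure P] {n k : ℕ} (hk : k ≤ n) (hn : 1 ≤ n)
    {X : Ω → EuclideanSpace ℝ (Fin n)} {E : Ω → Grassmannian n k} (hXm : Measurable X)
    (hEm : Measurable E) (hE : P.map E = grassmannianHaar hk) (hXE : IndepFun X E P)
    (hX0 : P.map X {0} = 0) {A : Set ℝ} (hA : MeasurableSet A) :
    P {ω | ‖(E ω).1.starProjection (X ω)‖ ^ 2 / ‖X ω‖ ^ 2 ∈ A} =
      genGaussianVec 2 n {g | coordRatio k g ∈ A} := by
  have hset : MeasurableSet {z : EuclideanSpace ℝ (Fin n) × Grassmannian n k |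
      ‖z.2.1.starProjection z.1‖ ^ 2 / ‖z.1‖ ^ 2 ∈ A} :=
    (((measurable_norm_starProjection n k).pow_const 2).div
      ((measurable_norm.comp measurable_fst).pow_const 2)) hA
  have hmap := (indepFun_iff_map_prod_eq_prod_map_map hXm.aemeasurable hEm.aemeasurable).mp hXE
  have h1 := Measure.map_apply (μ := P) (hXm.prodMk hEm) hset
  have hprob : IsProbabilityMeasure (P.map X) := Measure.isProbabilityMeasure_map hXm.aemeasurable
  have hae : ∀ᵐ y ∂(P.map X), y ≠ 0 := by
    rw [ae_iff]
    simpa using hX0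
  rw [hmap, hE, Measure.prod_apply hset] at h1
  have h2 := h1.symm.trans (lintegral_congr_ae (g := fun _ => genGaussianVec 2 n
    {g | coordRatio k g ∈ A})
    (hae.mono fun x hx => grassmannianHaar_norm_sq_mem hk hn hA hx))
  simpa using h2

/-! ### One-sided large deviations and multiplicative perturbations -/

section Perturbation

variable {Ω : ℕ → Type*} [∀ n, MeasurableSpace (Ω n)]

/-- `H n` converges to `h` in probability, superexponentially fast at speed `n ^ q`. -/
def SuperexpConcentrated (μ : ∀ n, Measure (Ω n)) (H : ∀ n, Ω n → ℝ) (q h : ℝ) : Prop :=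
  ∀ δ, 0 < δ → ∀ b, ∀ᶠ n : ℕ in atTop,
    (μ n).real {ω | δ ≤ |H n ω - h|} ≤ Real.exp (-(b * (n : ℝ) ^ q))

/-- Logarithmic tail bounds at speed `n ^ q` with rate `J` on `[t, ∞)` and infinite rate below
`t`. -/
structure OneSidedLDP (μ : ∀ n, Measure (Ω n)) (F : ∀ n, Ω n → ℝ) (q t : ℝ) (J : ℝ → ℝ) :
    Prop where
  upper_tail : ∀ y, t < y → ∀ b, b < J y → ∀ᶠ n : ℕ in atTop,
    (μ n).real {ω | F n ω ∈ Set.Ici y} ≤ Real.exp (-(b * (n : ℝ) ^ q))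
  lower_tail : ∀ y, y < t → ∀ b, ∀ᶠ n : ℕ in atTop,
    (μ n).real {ω | F n ω ∈ Set.Iic y} ≤ Real.exp (-(b * (n : ℝ) ^ q))
  lower_bound : ∀ y, t ≤ y → ∀ η, 0 < η → ∀ b, J y < b → ∀ᶠ n : ℕ in atTop,
    Real.exp (-(b * (n : ℝ) ^ q)) ≤ (μ n).real {ω | F n ω ∈ Set.Ioo y (y + η)}

theorem OneSidedLDP.congr {Ω' : ℕ → Type*} [∀ n, MeasurableSpace (Ω' n)]
    {μ : ∀ n, Measure (Ω n)} {μ' : ∀ n, Measure (Ω' n)} {F : ∀ n, Ω n → ℝ}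
    {F' : ∀ n, Ω' n → ℝ} {q t : ℝ} {J : ℝ → ℝ} (hF : OneSidedLDP μ F q t J)
    (h : ∀ n, 1 ≤ n → ∀ A : Set ℝ, MeasurableSet A →
      (μ n).real {ω | F n ω ∈ A} = (μ' n).real {ω | F' n ω ∈ A}) :
    OneSidedLDP μ' F' q t J where
  upper_tail y hy b hb := by
    filter_upwards [hF.upper_tail y hy b hb, eventually_ge_atTop 1] with n hn hn1
    rwa [← h n hn1 _ measurableSet_Ici]
  lower_tail y hy b := by
    filter_upwards [hF.lower_tail y hy b, eventually_ge_atTop 1] with n hn hn1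
    rwa [← h n hn1 _ measurableSet_Iic]
  lower_bound y hy η hη b hb := by
    filter_upwards [hF.lower_bound y hy η hη b hb, eventually_ge_atTop 1] with n hn hn1
    rwa [← h n hn1 _ measurableSet_Ioo]

theorem SuperexpConcentrated.comp_continuousAt {μ : ∀ n, Measure (Ω n)}
    [∀ n, IsProbabilityMeasure (μ n)] {H : ∀ n, Ω n → ℝ} {q h : ℝ}
    (hH : SuperexpConcentrated μ H q h) {g : ℝ → ℝ} (hg : ContinuousAt g h) :
    SuperexpConcentrated μ (fun n ω => g (H n ω)) q (g h) := by
  intro δ hδ b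
  obtain ⟨ε, hε, hεδ⟩ := Metric.continuousAt_iff.mp hg δ hδ
  filter_upwards [hH ε hε b] with n hn
  refine (measureReal_mono fun ω hω => ?_).trans hn
  by_contra hcon
  exact absurd (hεδ (not_le.mp hcon)) (not_lt.mpr hω)

theorem SuperexpConcentrated.mul {μ : ∀ n, Measure (Ω n)}
    [∀ n, IsProbabilityMeasure (μ n)] {H H' : ∀ n, Ω n → ℝ} {q h h' : ℝ} (hq : 0 < q)
    (hH : SuperexpConcentrated μ H q h) (hH' : SuperexpConcentrated μ H' q h') :
    SuperexpConcentrated μ (fun n ω => H n ω * H' n ω) q (h * h') := by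
  intro δ hδ b
  have hc : ContinuousAt (fun z : ℝ × ℝ => z.1 * z.2) (h, h') := by fun_prop
  obtain ⟨ε, hε, hεδ⟩ := Metric.continuousAt_iff.mp hc δ hδ
  filter_upwards [hH ε hε (b + 1), hH' ε hε (b + 1),
    eventually_const_mul_exp_le hq 2 (lt_add_one b)] with n h1 h2 h3
  have hsub : {ω | δ ≤ |H n ω * H' n ω - h * h'|} ⊆
      {ω | ε ≤ |H n ω - h|} ∪ {ω | ε ≤ |H' n ω - h'|} := by
    intro ω hω
    by_contra hcon
    simp only [Set.mem_union, Set.mem_ofPred_eq, not_or, not_le] at hcon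
    have h4 : dist (H n ω, H' n ω) (h, h') < ε := by
      rw [Prod.dist_eq]
      exact max_lt hcon.1 hcon.2
    exact absurd (hεδ h4) (not_lt.mpr hω)
  have h5 := (measureReal_mono (μ := μ n) hsub).trans (measureReal_union_le _ _)
  linarith

theorem exists_small_pos {P : ℝ → Prop} (h : ∀ᶠ δ in 𝓝 (0 : ℝ), P δ) : ∃ δ, 0 < δ ∧ P δ := by
  obtain ⟨δ, h1, h2⟩ :=
    ((eventually_mem_nhdsWithin (s := Set.Ioi (0 : ℝ))).and (h.filter_mono nhdsWithin_le_nhds)).exists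
  exact ⟨δ, h1, h2⟩

/-- Outside an event that is negligible at this speed, `H` lies within `δ` of `h`; since `F ≥ 0`,
the product then lies between `F (h - δ)` and `F (h + δ)`. Continuity of `J` lets `δ` be small at an
arbitrarily small loss in the rate. -/
theorem OneSidedLDP.mul {μ : ∀ n, Measure (Ω n)} [∀ n, IsProbabilityMeasure (μ n)]
    {F H : ∀ n, Ω n → ℝ} {q t h : ℝ} {J : ℝ → ℝ} (hq : 0 < q) (hh : 0 < h)
    (hF0 : ∀ n ω, 0 ≤ F n ω) (hJ : Continuous J) (hF : OneSidedLDP μ F q t J)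
    (hH : SuperexpConcentrated μ H q h) :
    OneSidedLDP μ (fun n ω => F n ω * H n ω) q (h * t) (fun y => J (y / h)) where
  upper_tail y hy b hb := by
    have hc : ContinuousAt (fun δ : ℝ => y / (h + δ)) 0 :=
      ContinuousAt.div (by fun_prop) (by fun_prop) (by simpa using hh.ne')
    obtain ⟨b', hb', hbJ⟩ := exists_between hb
    obtain ⟨δ, hδ, h1, h2⟩ := exists_small_pos
      ((hc.eventually_const_lt (show t < y / (h + 0) by
          rwa [add_zero, lt_div_iff₀ hh, mul_comm])).and
        ((hJ.continuousAt.comp hc).eventually_const_lt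
          (show b' < J (y / (h + 0)) by rwa [add_zero])))
    filter_upwards [hF.upper_tail _ h1 b' h2, hH δ hδ b',
      eventually_const_mul_exp_le hq 2 hb'] with n h3 h4 h5
    have hsub : {ω | F n ω * H n ω ∈ Set.Ici y} ⊆
        {ω | F n ω ∈ Set.Ici (y / (h + δ))} ∪ {ω | δ ≤ |H n ω - h|} := by
      intro ω hω
      by_contra hcon
      simp only [Set.mem_union, Set.mem_ofPred_eq, Set.mem_Ici, not_or, not_le] at hcon hω
      have h6 := (abs_lt.mp hcon.2).2
      rw [lt_div_iff₀ (by positivity)] at hcon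
      nlinarith [hF0 n ω]
    have h7 := (measureReal_mono (μ := μ n) hsub).trans (measureReal_union_le _ _)
    linarith
  lower_tail y hy b := by
    have hc : ContinuousAt (fun δ : ℝ => y / (h - δ)) 0 :=
      ContinuousAt.div (by fun_prop) (by fun_prop) (by simpa using hh.ne')
    obtain ⟨δ, hδ, h1, h2⟩ := exists_small_pos
      ((hc.eventually_lt_const (show y / (h - 0) < t by
          rwa [sub_zero, div_lt_iff₀ hh, mul_comm])).and (eventually_lt_nhds hh))
    filter_upwards [hF.lower_tail _ h1 (b + 1), hH δ hδ (b + 1),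
      eventually_const_mul_exp_le hq 2 (lt_add_one b)] with n h3 h4 h5
    have hsub : {ω | F n ω * H n ω ∈ Set.Iic y} ⊆
        {ω | F n ω ∈ Set.Iic (y / (h - δ))} ∪ {ω | δ ≤ |H n ω - h|} := by
      intro ω hω
      by_contra hcon
      simp only [Set.mem_union, Set.mem_ofPred_eq, Set.mem_Iic, not_or, not_le] at hcon hω
      have h6 := (abs_lt.mp hcon.2).1
      rw [div_lt_iff₀ (by linarith)] at hcon
      nlinarith [hF0 n ω]
    have h7 := (measureReal_mono (μ := μ n) hsub).trans (measureReal_union_le _ _)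
    linarith
  lower_bound y hy η hη b hb := by
    have hyt : t ≤ y / h := by rwa [le_div_iff₀ hh, mul_comm]
    -- `F` is localized in `(y/h + ε, y/h + 2ε)`, strictly above `y/h`, so that the product still
    -- exceeds `y` when `H` falls slightly below `h`.
    obtain ⟨ε, hε, h1, h2⟩ := exists_small_pos
      (((show Continuous fun ε : ℝ => J (y / h + ε) by fun_prop).continuousAt.eventually_lt_const
          (show J (y / h + 0) < b by rwa [add_zero])).and
        ((show Continuous fun ε : ℝ => (y / h + (ε + ε)) * h by
          fun_prop).continuousAt.eventually_lt_const
          (show (y / h + (0 + 0)) * h < y + η by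
            rw [add_zero, add_zero, div_mul_cancel₀ _ hh.ne']; linarith)))
    obtain ⟨δ, hδ, h3, h4, h5⟩ := exists_small_pos
      (((show Continuous fun δ : ℝ => (y / h + ε) * (h - δ) by
          fun_prop).continuousAt.eventually_const_lt
          (show y < (y / h + ε) * (h - 0) by
            rw [sub_zero, add_mul, div_mul_cancel₀ _ hh.ne']; nlinarith)).and
        (((show Continuous fun δ : ℝ => (y / h + (ε + ε)) * (h + δ) by
          fun_prop).continuousAt.eventually_lt_const
          (show (y / h + (ε + ε)) * (h + 0) < y + η by rwa [add_zero])).and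
          (eventually_lt_nhds hh)))
    obtain ⟨b', hb', hbb'⟩ := exists_between h1
    filter_upwards [hF.lower_bound (y / h + ε) (by linarith) ε hε b' hb', hH δ hδ b,
      eventually_const_mul_exp_le hq 2 hbb'] with n h6 h7 h8
    have hsub : {ω | F n ω ∈ Set.Ioo (y / h + ε) (y / h + ε + ε)} ⊆
        {ω | F n ω * H n ω ∈ Set.Ioo y (y + η)} ∪ {ω | δ ≤ |H n ω - h|} := by
      intro ω hω
      by_contra hcon
      simp only [Set.mem_union, Set.mem_ofPred_eq, Set.mem_Ioo, not_or, not_le] at hcon hω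
      obtain ⟨h9, h10⟩ := abs_lt.mp hcon.2
      refine hcon.1 ⟨h3.trans_le ?_, lt_of_le_of_lt ?_ h4⟩
      · exact mul_le_mul hω.1.le (by linarith) (by linarith) (hF0 n ω)
      · exact mul_le_mul (by linarith) (by linarith) (by linarith) ((hF0 n ω).trans (by linarith))
    have h11 := (measureReal_mono (μ := μ n) hsub).trans (measureReal_union_le _ _)
    linarith

end Perturbation

/-! ### The squared norm of the projected random vector -/

/-- The rate function of the empirical second moment of `p`-generalized Gaussians, above `m_p`. -/
def secondMomentRate (p y : ℝ) : ℝ := 1 / p * (y - mConst p) ^ (p / 2)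

theorem continuous_secondMomentRate {p : ℝ} (hp : 0 < p) : Continuous (secondMomentRate p) :=
  continuous_const.mul ((continuous_id.sub continuous_const).rpow_const
    fun _ => Or.inr (by positivity))

theorem oneSidedLDP_sum_sq {p : ℝ} (hp : 0 < p) (hp2 : p < 2) :
    OneSidedLDP (fun n => Measure.pi fun _ : Fin n => genGaussian p)
      (fun n z => (∑ i, z i ^ 2) / n) (p / 2) (mConst p) (secondMomentRate p) where
  upper_tail y hy b hb := by
    filter_upwards [eventually_genGaussian_le_sum_sq_le hp hp2 (sub_pos.mpr hy) hb,
      eventually_gt_atTop 0] with n hn hn0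
    have hn0 : (0 : ℝ) < n := by exact_mod_cast hn0
    simpa only [Set.mem_Ici, le_div_iff₀ hn0, add_sub_cancel, mul_comm y] using hn
  lower_tail y hy b := by
    have := isProbabilityMeasure_genGaussian hp
    obtain ⟨c, hc, h⟩ := exists_genGaussian_sum_sq_le hp (sub_pos.mpr hy)
    filter_upwards [eventually_mul_exp_neg_le (show p / 2 < 1 by linarith) 1 hc b,
      eventually_gt_atTop 0] with n hn hn0
    have hn0 : (0 : ℝ) < n := by exact_mod_cast hn0
    have h1 := (h n).trans ((one_mul _).symm.le.trans hn)
    simpa only [Set.mem_Iic, div_le_iff₀ hn0, sub_sub_cancel, mul_comm y] using h1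
  lower_bound y hy η hη b hb := by
    filter_upwards [eventually_le_genGaussian_sum_sq hp hp2 (sub_nonneg.mpr hy) hη hb,
      eventually_gt_atTop 0] with n hn hn0
    have hn0 : (0 : ℝ) < n := by exact_mod_cast hn0
    simpa only [Set.mem_Ioo, lt_div_iff₀ hn0, div_lt_iff₀ hn0, add_sub_cancel,
      mul_comm (n : ℝ)] using hn

theorem superexpConcentrated_sum_abs_rpow {p : ℝ} (hp : 0 < p) {q : ℝ} (hq : q < 1) :
    SuperexpConcentrated (fun n => Measure.pi fun _ : Fin n => genGaussian p)
      (fun n z => (∑ i, |z i| ^ p) / n) q 1 := by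
  intro δ hδ b
  obtain ⟨c, hc, h⟩ := exists_genGaussian_abs_rpow_concentration hp hδ
  filter_upwards [eventually_mul_exp_neg_le hq 2 hc b, eventually_gt_atTop 0] with n hn hn0
  have hn0 : (0 : ℝ) < n := by exact_mod_cast hn0
  have h1 := h n Finset.univ
  rw [Finset.card_univ, Fintype.card_fin] at h1
  refine le_trans (le_of_eq ?_) (h1.trans hn)
  congr 1
  ext z
  rw [Set.mem_ofPred_eq, Set.mem_ofPred_eq, div_sub_one hn0.ne', abs_div, abs_of_pos hn0,
    le_div_iff₀ hn0, mul_comm]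

/-- The normalized ratio `n^{2/p-1} ‖x‖₂² / ‖x‖_p²`. -/
def normRatio (p : ℝ) {n : ℕ} (x : EuclideanSpace ℝ (Fin n)) : ℝ :=
  (n : ℝ) ^ (2 / p - 1) * (∑ i, x i ^ 2) / (∑ i, |x i| ^ p) ^ (2 / p)

theorem normRatio_nonneg (p : ℝ) {n : ℕ} (x : EuclideanSpace ℝ (Fin n)) : 0 ≤ normRatio p x := by
  unfold normRatio
  positivity

theorem measurable_normRatio (p : ℝ) (n : ℕ) :
    Measurable (normRatio p : EuclideanSpace ℝ (Fin n) → ℝ) := by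
  unfold normRatio
  fun_prop

theorem normRatio_smul {p : ℝ} (hp : 0 < p) {n : ℕ} {r : ℝ} (hr : 0 < r)
    (x : EuclideanSpace ℝ (Fin n)) : normRatio p (r • x) = normRatio p x := by
  have h0 : 0 ≤ ∑ i, |x i| ^ p := Finset.sum_nonneg fun i _ => by positivity
  have h1 : (r ^ p) ^ (2 / p) = r ^ 2 := by
    rw [← Real.rpow_mul hr.le, mul_div_cancel₀ _ hp.ne', Real.rpow_ofNat]
  unfold normRatio
  rw [sum_abs_smul_rpow hr.le, Real.mul_rpow (by positivity) h0, h1]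
  simp only [PiLp.smul_apply, smul_eq_mul, mul_pow, ← Finset.mul_sum]
  rw [mul_left_comm]
  exact mul_div_mul_left _ _ (pow_ne_zero 2 hr.ne')

theorem uniform_lpBall_normRatio_mem {p : ℝ} (hp : 0 < p) (n : ℕ) {A : Set ℝ}
    (hA : MeasurableSet A) :
    ProbabilityTheory.cond volume (lpBall n p) {x | normRatio p x ∈ A} =
      (Measure.pi fun _ : Fin n => genGaussian p) {z | normRatio p (WithLp.toLp 2 z) ∈ A} := by
  have hm : MeasurableSet {x : EuclideanSpace ℝ (Fin n) | normRatio p x ∈ A} :=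
    measurable_normRatio p n hA
  rw [uniform_lpBall_cone_eq hp hm, genGaussianVec_apply p hm]
  · rfl
  · intro r hr x hx
    rwa [Set.mem_ofPred_eq, normRatio_smul hp hr]

theorem normRatio_toLp_eq (p : ℝ) {n : ℕ} (hn : 1 ≤ n) (z : Fin n → ℝ) :
    (∑ i, z i ^ 2) / n * ((∑ i, |z i| ^ p) / n) ^ (-(2 / p)) =
      normRatio p (WithLp.toLp 2 z) := by
  have hn0 : (0 : ℝ) < n := by exact_mod_cast hn
  have h0 : 0 ≤ ∑ i, |z i| ^ p := Finset.sum_nonneg fun i _ => by positivity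
  unfold normRatio
  rw [Real.rpow_neg (by positivity), Real.div_rpow h0 hn0.le, Real.rpow_sub_one hn0.ne', inv_div]
  ring

/-- Scale invariance replaces `X` by independent generalized Gaussians. There the ratio is the mean
of squares times a power of the mean of `|z_i|^p`, and the latter factor concentrates at 1. -/
theorem oneSidedLDP_normRatio {p : ℝ} (hp : 0 < p) (hp2 : p < 2) {Ω : Type*} [MeasurableSpace Ω]
    {P : Measure Ω} {X : ∀ n, Ω → EuclideanSpace ℝ (Fin n)}
    (hXm : ∀ n, 1 ≤ n → Measurable (X n))
    (hX : ∀ n, 1 ≤ n → pdf.IsUniform (X n) (lpBall n p) P volume) :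
    OneSidedLDP (fun _ => P) (fun n ω => normRatio p (X n ω)) (p / 2) (mConst p)
      (secondMomentRate p) := by
  have := isProbabilityMeasure_genGaussian hp
  have hV := (superexpConcentrated_sum_abs_rpow hp (show p / 2 < 1 by linarith)).comp_continuousAt
    (g := fun v => v ^ (-(2 / p))) (Real.continuousAt_rpow_const _ _ (Or.inl one_ne_zero))
  rw [Real.one_rpow] at hV
  have h := (oneSidedLDP_sum_sq hp hp2).mul (by positivity) one_pos (fun n z => by positivity)
    (continuous_secondMomentRate hp) hV
  simp only [one_mul, div_one] at h
  refine h.congr fun n hn A hA => ?_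
  have hm : MeasurableSet {x : EuclideanSpace ℝ (Fin n) | normRatio p x ∈ A} :=
    measurable_normRatio p n hA
  simp only [normRatio_toLp_eq p hn]
  rw [measureReal_def, ← uniform_lpBall_normRatio_mem hp n hA, ← hX n hn,
    Measure.map_apply (hXm n hn) hm, measureReal_def]
  rfl

theorem superexpConcentrated_lpNorm {p : ℝ} (hp : 0 < p) {q : ℝ} (hq : q < 1)
    {Ω : Type*} [MeasurableSpace Ω]
    {P : Measure Ω} [IsProbabilityMeasure P] {X : ∀ n, Ω → EuclideanSpace ℝ (Fin n)}
    (hXm : ∀ n, 1 ≤ n → Measurable (X n))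
    (hX : ∀ n, 1 ≤ n → pdf.IsUniform (X n) (lpBall n p) P volume) :
    SuperexpConcentrated (fun _ => P) (fun n ω => ∑ i, |X n ω i| ^ p) q 1 := by
  intro δ hδ b
  -- The maximum with `1/2` keeps `r` positive when `δ ≥ 1`.
  set r : ℝ := max (1 / 2) (1 - δ) ^ (1 / p)
  have hmax : 0 < max (1 / 2) (1 - δ) := lt_max_of_lt_left (by norm_num)
  have hmax1 : max (1 / 2) (1 - δ) < 1 := max_lt (by norm_num) (by linarith)
  have hr : 0 < r := by positivity
  have hr1 : r < 1 := Real.rpow_lt_one hmax.le hmax1 (by positivity)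
  have hrp : r ^ p = max (1 / 2) (1 - δ) := by
    rw [← Real.rpow_mul hmax.le, one_div_mul_cancel hp.ne', Real.rpow_one]
  filter_upwards [eventually_mul_exp_neg_le hq 1 (neg_pos.mpr (Real.log_neg hr hr1)) b,
    eventually_ge_atTop 1] with n hn hn1
  have hm := measurable_sum_abs_rpow p n
  have hm1 : MeasurableSet {x : EuclideanSpace ℝ (Fin n) | ∑ i, |x i| ^ p ≤ r ^ p} :=
    measurableSet_le hm measurable_const
  have h1 : P.real {ω | ∑ i, |X n ω i| ^ p ≤ r ^ p} = r ^ n := by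
    have h := uniform_lpBall_sum_le hp (n := n) hr hr1.le
    rw [← hX n hn1, Measure.map_apply (hXm n hn1) hm1] at h
    rw [measureReal_def]
    exact (congrArg ENNReal.toReal h).trans (ENNReal.toReal_ofReal (by positivity))
  have h2 : P.real {ω | 1 < ∑ i, |X n ω i| ^ p} = 0 := by
    have hm2 : MeasurableSet {x : EuclideanSpace ℝ (Fin n) | 1 < ∑ i, |x i| ^ p} :=
      measurableSet_lt measurable_const hm
    have h : ProbabilityTheory.cond volume (lpBall n p)
        {x : EuclideanSpace ℝ (Fin n) | 1 < ∑ i, |x i| ^ p} = 0 := by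
      rw [cond_apply (measurableSet_lpBall hp n), lpBall_eq hp]
      have : {x : EuclideanSpace ℝ (Fin n) | ∑ i, |x i| ^ p ≤ 1} ∩
          {x | 1 < ∑ i, |x i| ^ p} = ∅ := by
        ext x
        simp
      rw [this, measure_empty, mul_zero]
    rw [← hX n hn1, Measure.map_apply (hXm n hn1) hm2] at h
    rw [measureReal_def]
    exact congrArg ENNReal.toReal h
  have hsub : {ω | δ ≤ |∑ i, |X n ω i| ^ p - 1|} ⊆
      {ω | ∑ i, |X n ω i| ^ p ≤ r ^ p} ∪ {ω | 1 < ∑ i, |X n ω i| ^ p} := by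
    intro ω hω
    by_contra hcon
    simp only [Set.mem_union, Set.mem_ofPred_eq, not_or, not_le, not_lt] at hcon hω
    rw [abs_of_nonpos (by linarith), hrp] at *
    linarith [le_max_right (1 / 2) (1 - δ)]
  refine (measureReal_mono hsub).trans ((measureReal_union_le _ _).trans ?_)
  rw [h1, h2, add_zero]
  refine le_trans (le_of_eq ?_) hn
  rw [one_mul, neg_mul, neg_neg, mul_comm, Real.exp_nat_mul, Real.exp_log hr]

theorem abs_div_sub_div_le {s t k n x : ℝ} (hn : 0 < n) (hk0 : 0 ≤ k) (hkn : k ≤ n)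
    (hx0 : 0 ≤ x) (hx : x ≤ 1 / 2) (hs : |s - k| ≤ k * x) (ht : |t - n| ≤ n * x) :
    |s / t - k / n| ≤ 4 * x := by
  obtain ⟨hs1, hs2⟩ := abs_le.mp hs
  obtain ⟨ht1, ht2⟩ := abs_le.mp ht
  have ht0 : n / 2 ≤ t := by nlinarith
  have htp : 0 < t := by linarith
  rw [div_sub_div _ _ htp.ne' hn.ne', abs_div, abs_of_pos (mul_pos htp hn),
    div_le_iff₀ (mul_pos htp hn)]
  have h1 : |s * n - t * k| ≤ 2 * (k * x * n) := by
    rw [abs_le]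
    constructor <;> nlinarith
  refine h1.trans ?_
  have h2 : 0 ≤ x * n := by positivity
  nlinarith

/-- Numerator and denominator are sums of `k_n` and `n` squared standard Gaussians, each
concentrated near its number of terms. Since `λ > 0`, eventually `k_n ≥ n λ/2`, so both errors are
exponential in `n`. -/
theorem superexpConcentrated_coordRatio {k : ℕ → ℕ} (hk : ∀ n, k n ≤ n) {lam : ℝ}
    (hlam : 0 < lam) (hlim : Tendsto (fun n => (k n : ℝ) / (n : ℝ)) atTop (𝓝 lam)) {q : ℝ}
    (hq : q < 1) :
    SuperexpConcentrated (fun n => genGaussianVec 2 n) (fun n g => coordRatio (k n) g) q lam := by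
  intro δ hδ b
  have := isProbabilityMeasure_genGaussian two_pos
  -- The ratio is then within `4x ≤ δ/4` of `k_n/n`, which is itself within `δ/4` of `λ`.
  set x := min (1 / 2) (δ / 16)
  have hx : 0 < x := by positivity
  obtain ⟨c, hc, h⟩ := exists_genGaussian_abs_rpow_concentration two_pos hx
  filter_upwards [eventually_mul_exp_neg_le hq 4 (show 0 < c * (lam / 2) by positivity) b,
    hlim.eventually_const_lt (half_lt_self hlam),
    Metric.tendsto_nhds.mp hlim (δ / 4) (by positivity), eventually_ge_atTop 1] with n h1 h2 h3 h4
  have hn0 : (0 : ℝ) < n := by exact_mod_cast h4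
  have hkn : (k n : ℝ) ≤ n := by exact_mod_cast hk n
  rw [lt_div_iff₀ hn0] at h2
  have hset : MeasurableSet {g : EuclideanSpace ℝ (Fin n) | δ ≤ |coordRatio (k n) g - lam|} :=
    measurableSet_le measurable_const (((measurable_coordRatio (k n)).sub_const lam).norm)
  rw [measureReal_def, genGaussianVec_apply 2 hset, ← measureReal_def]
  set S : Finset (Fin n) := Finset.univ.filter fun i => i.val < k n
  have hS : S.card = k n := by
    rw [← Fintype.card_subtype, Fintype.card_subtype, Fin.card_filter_val_lt, min_eq_right (hk n)]
  have hA := h n S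
  have hB := h n Finset.univ
  rw [Finset.card_univ, Fintype.card_fin] at hB
  rw [hS] at hA
  simp only [Real.rpow_ofNat, sq_abs] at hA hB
  have hsub : (WithLp.toLp 2 ⁻¹' {g : EuclideanSpace ℝ (Fin n) |
      δ ≤ |coordRatio (k n) g - lam|}) ⊆
      {z : Fin n → ℝ | k n * x ≤ |∑ i ∈ S, z i ^ 2 - k n|} ∪
        {z | n * x ≤ |∑ i, z i ^ 2 - n|} := by
    intro z hz
    by_contra hcon
    simp only [Set.mem_union, Set.mem_ofPred_eq, not_or, not_le] at hcon
    have h5 := abs_div_sub_div_le hn0 (Nat.cast_nonneg _) hkn hx.le (min_le_left _ _)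
      hcon.1.le hcon.2.le
    have h6 : δ ≤ |(∑ i ∈ S, z i ^ 2) / ∑ i, z i ^ 2 - lam| := hz
    have h7 := abs_sub_le ((∑ i ∈ S, z i ^ 2) / ∑ i, z i ^ 2) (k n / n) lam
    rw [Real.dist_eq] at h3
    linarith [min_le_right (1 / 2) (δ / 16)]
  have e1 : Real.exp (-(c * k n)) ≤ Real.exp (-(c * (lam / 2) * n)) := by
    rw [mul_assoc]
    gcongr
  have e2 : Real.exp (-(c * n)) ≤ Real.exp (-(c * (lam / 2) * n)) := by
    rw [mul_assoc]
    gcongr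
    linarith
  refine (measureReal_mono hsub).trans ((measureReal_union_le _ _).trans ?_)
  linarith

theorem oneSidedLDP_normalizedProjNorm_sq {p : ℝ} (hp : 0 < p) (hp2 : p < 2) {Ω : Type*}
    [MeasurableSpace Ω] {P : Measure Ω} [IsProbabilityMeasure P]
    {k : ℕ → ℕ} (hk : ∀ n, k n ≤ n) {lam : ℝ} (hlam : 0 < lam)
    (hlim : Tendsto (fun n => (k n : ℝ) / (n : ℝ)) atTop (𝓝 lam))
    {X : ∀ n, Ω → EuclideanSpace ℝ (Fin n)} {E : ∀ n, Ω → Grassmannian n (k n)}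
    (hXm : ∀ n, 1 ≤ n → Measurable (X n)) (hEm : ∀ n, 1 ≤ n → Measurable (E n))
    (hX : ∀ n, 1 ≤ n → pdf.IsUniform (X n) (lpBall n p) P volume)
    (hE : ∀ n, 1 ≤ n → P.map (E n) = grassmannianHaar (hk n))
    (hXE : ∀ n, 1 ≤ n → IndepFun (X n) (E n) P) :
    OneSidedLDP (fun _ => P) (fun n ω => normalizedProjNorm p (E n ω) (X n ω) ^ 2) (p / 2)
      (lam * mConst p) (fun y => secondMomentRate p (y / lam)) := by
  have hq : p / 2 < 1 := by linarith
  have hq0 : 0 < p / 2 := by positivity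
  have h1 := (superexpConcentrated_lpNorm hp hq hXm hX).comp_continuousAt
    (g := fun v => v ^ (2 / p)) (Real.continuousAt_rpow_const _ _ (Or.inl one_ne_zero))
  have h2 : SuperexpConcentrated (fun _ => P)
      (fun n ω => ‖(E n ω).1.starProjection (X n ω)‖ ^ 2 / ‖X n ω‖ ^ 2) (p / 2) lam := by
    intro δ hδ b
    filter_upwards [superexpConcentrated_coordRatio hk hlam hlim hq δ hδ b,
      eventually_ge_atTop 1] with n h3 hn
    have hA : MeasurableSet {u : ℝ | δ ≤ |u - lam|} :=
      measurableSet_le measurable_const (measurable_id.sub_const lam).norm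
    have hX0 : P.map (X n) {0} = 0 := by
      have : Nonempty (Fin n) := ⟨⟨0, hn⟩⟩
      exact (hX n hn).absolutelyContinuous (measure_singleton 0)
    have h4 := prob_norm_starProjection_sq_mem (hk n) hn (hXm n hn) (hEm n hn) (hE n hn)
      (hXE n hn) hX0 hA
    exact (congrArg ENNReal.toReal h4).trans_le h3
  have h3 := h1.mul hq0 h2
  rw [Real.one_rpow, one_mul] at h3
  refine ((oneSidedLDP_normRatio hp hp2 hXm hX).mul hq0 hlam (fun n ω => normRatio_nonneg p _)
    (continuous_secondMomentRate hp) h3).congr fun n hn A _ => ?_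
  congr 1
  ext ω
  refine iff_of_eq (congrArg (· ∈ A) ?_)
  have hn0 : (0 : ℝ) < n := by exact_mod_cast hn
  -- At `X = 0` the quotients take the value 0, so both sides vanish and the factorization holds
  -- pointwise.
  rcases eq_or_ne (X n ω) 0 with h0 | h0
  · simp [h0, normRatio, normalizedProjNorm]
  have hnorm : ‖X n ω‖ ^ 2 ≠ 0 := pow_ne_zero 2 (norm_ne_zero_iff.mpr h0)
  have hsum : 0 < ∑ i, |X n ω i| ^ p := by
    refine Finset.sum_pos' (fun i _ => by positivity) ?_
    by_contra! hcon
    refine h0 (PiLp.ext fun i => ?_)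
    by_contra hi
    exact absurd (hcon i (Finset.mem_univ i)) (not_le.mpr (Real.rpow_pos_of_pos (abs_pos.mpr hi) p))
  have hsum' : (∑ i, |X n ω i| ^ p) ^ (2 / p) ≠ 0 := (Real.rpow_pos_of_pos hsum _).ne'
  have hpow : ((n : ℝ) ^ (1 / p - 1 / 2)) ^ 2 = (n : ℝ) ^ (2 / p - 1) := by
    rw [← Real.rpow_natCast, ← Real.rpow_mul hn0.le]
    congr 1
    push_cast
    ring
  have hsq : ∑ i, X n ω i ^ 2 = ‖X n ω‖ ^ 2 := by simp [EuclideanSpace.norm_sq_eq]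
  unfold normRatio normalizedProjNorm
  rw [hsq, mul_pow, hpow]
  field_simp

/-! ### The large deviation principle -/

theorem OneSidedLDP.of_sq {Ω : ℕ → Type*} [∀ n, MeasurableSpace (Ω n)]
    {μ : ∀ n, Measure (Ω n)} [∀ n, IsProbabilityMeasure (μ n)] {Y : ∀ n, Ω n → ℝ} {q t : ℝ}
    {J : ℝ → ℝ} (hY : ∀ n ω, 0 ≤ Y n ω)
    (h : OneSidedLDP μ (fun n ω => Y n ω ^ 2) q t J) :
    OneSidedLDP μ Y q √t (fun y => J (y ^ 2)) where
  upper_tail y hy b hb := by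
    have hy0 : 0 < y := (Real.sqrt_nonneg t).trans_lt hy
    filter_upwards [h.upper_tail (y ^ 2) ((Real.sqrt_lt' hy0).mp hy) b hb] with n hn
    exact (measureReal_mono fun ω hω => pow_le_pow_left₀ hy0.le hω 2).trans hn
  lower_tail y hy b := by
    rcases lt_or_ge y 0 with hy0 | hy0
    · refine .of_forall fun n => ?_
      have : {ω | Y n ω ∈ Set.Iic y} = ∅ := by
        ext ω
        simpa using hy0.trans_le (hY n ω)
      rw [this, measureReal_empty]
      exact (Real.exp_pos _).le
    · filter_upwards [h.lower_tail (y ^ 2) ((Real.lt_sqrt hy0).mp hy) b] with n hn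
      exact (measureReal_mono fun ω hω => pow_le_pow_left₀ (hY n ω) hω 2).trans hn
  lower_bound y hy η hη b hb := by
    have hy0 : 0 ≤ y := (Real.sqrt_nonneg t).trans hy
    filter_upwards [h.lower_bound (y ^ 2) ((Real.sqrt_le_left hy0).mp hy)
      ((y + η) ^ 2 - y ^ 2) (by nlinarith) b hb] with n hn
    rw [add_sub_cancel] at hn
    refine hn.trans (measureReal_mono fun ω hω => ?_)
    exact ⟨lt_of_pow_lt_pow_left₀ 2 (hY n ω) hω.1, lt_of_pow_lt_pow_left₀ 2 (by positivity) hω.2⟩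

theorem log_measure_div_le_of_real_le_exp {Ω : Type*} [MeasurableSpace Ω] {P : Measure Ω}
    [IsFiniteMeasure P] {A : Set Ω} {b s : ℝ} (hs : 0 < s)
    (h : P.real A ≤ Real.exp (-(b * s))) :
    ENNReal.log (P A) / (s : EReal) ≤ ((-b : ℝ) : EReal) := by
  have h1 : P A ≤ ENNReal.ofReal (Real.exp (-(b * s))) := by
    rw [← ofReal_measureReal]
    exact ENNReal.ofReal_le_ofReal h
  have h2 := ENNReal.log_le_log h1
  rw [ENNReal.log_ofReal_of_pos (Real.exp_pos _), Real.log_exp] at h2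
  refine (EReal.div_le_div_right_of_nonneg (by exact_mod_cast hs.le) h2).trans_eq ?_
  rw [← EReal.coe_div]
  congr 1
  field_simp

theorem le_log_measure_div_of_exp_le_real {Ω : Type*} [MeasurableSpace Ω] {P : Measure Ω}
    [IsFiniteMeasure P] {A : Set Ω} {b s : ℝ} (hs : 0 < s)
    (h : Real.exp (-(b * s)) ≤ P.real A) :
    ((-b : ℝ) : EReal) ≤ ENNReal.log (P A) / (s : EReal) := by
  have h1 : ENNReal.ofReal (Real.exp (-(b * s))) ≤ P A := by
    rw [← ofReal_measureReal]
    exact ENNReal.ofReal_le_ofReal h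
  have h2 := ENNReal.log_le_log h1
  rw [ENNReal.log_ofReal_of_pos (Real.exp_pos _), Real.log_exp] at h2
  refine le_of_eq_of_le ?_ (EReal.div_le_div_right_of_nonneg (by exact_mod_cast hs.le) h2)
  rw [← EReal.coe_div]
  congr 1
  field_simp

/-- The effective domain of the rate is `[t, ∞)`, and `J` is nonnegative there with `J t = 0`. A
closed set missing `t` therefore lies in `(-∞, t - ε] ∪ [y, ∞)`, with `y` its least point above `t`,
and two tail bounds suffice. An open set contains a short interval to the right of each of its
points, which is what the lower bound needs. -/
theorem OneSidedLDP.satisfiesLDP {Ω : Type*} [MeasurableSpace Ω] {P : Measure Ω}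
    [IsProbabilityMeasure P] {Y : ℕ → Ω → ℝ} {q t : ℝ} {J : ℝ → ℝ} (hq : 0 < q)
    (hJ : Continuous J) (hJm : MonotoneOn J (Set.Ici t)) (hJt : J t = 0)
    (hJtop : Tendsto J atTop atTop) (h : OneSidedLDP (fun _ => P) Y q t J) {I : ℝ → ℝ≥0∞}
    (hI : ∀ y, t ≤ y → I y = ENNReal.ofReal (J y)) (hI' : ∀ y, y < t → I y = ⊤) :
    SatisfiesLDP P Y (fun n => (n : ℝ) ^ q) I := by
  have hJ0 : ∀ y, t ≤ y → 0 ≤ J y := fun y hy => hJt ▸ hJm Set.self_mem_Ici hy hy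
  have hIe : ∀ y, t ≤ y → (I y : EReal) = (J y : ℝ) := fun y hy => by
    rw [hI y hy, EReal.coe_ennreal_ofReal, max_eq_left (hJ0 y hy)]
  have hIlt : ∀ (y c : ℝ), (I y : EReal) ≤ c → t ≤ y := fun y c hy => by
    by_contra hcon
    rw [hI' y (not_le.mp hcon), EReal.coe_ennreal_top, top_le_iff] at hy
    exact EReal.coe_ne_top c hy
  have hspos : ∀ᶠ n : ℕ in atTop, 0 < (n : ℝ) ^ q := by
    filter_upwards [eventually_gt_atTop 0] with n hn
    have : (0 : ℝ) < n := by exact_mod_cast hn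
    positivity
  refine ⟨?_, fun α => ?_, fun A _ => ?_, fun A _ => ?_⟩
  · rw [lowerSemicontinuous_iff_isClosed_preimage]
    intro c
    rcases eq_or_ne c ⊤ with rfl | hc
    · simp
    have hset : I ⁻¹' Set.Iic c = Set.Ici t ∩ (fun y => ENNReal.ofReal (J y)) ⁻¹' Set.Iic c := by
      ext y
      by_cases hy : t ≤ y
      · simp [hy, hI y hy]
      · simp [hy, hI' y (not_le.mp hy), hc]
    rw [hset]
    exact isClosed_Ici.inter (isClosed_Iic.preimage (ENNReal.continuous_ofReal.comp hJ))
  · obtain ⟨M, hM⟩ := eventually_atTop.mp (hJtop.eventually_gt_atTop α)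
    have hset : {x : ℝ | (I x : EReal) ≤ (α : EReal)} = Set.Ici t ∩ J ⁻¹' Set.Iic α := by
      ext y
      refine ⟨fun hy => ⟨hIlt y α hy, ?_⟩, fun hy => ?_⟩
      · have h1 := hIlt y α hy
        rw [Set.mem_ofPred_eq, hIe y h1] at hy
        exact EReal.coe_le_coe_iff.mp hy
      · rw [Set.mem_ofPred_eq, hIe y hy.1]
        exact EReal.coe_le_coe_iff.mpr hy.2
    rw [hset]
    refine isCompact_Icc.of_isClosed_subset (isClosed_Ici.inter (isClosed_Iic.preimage hJ))
      (fun y hy => ⟨hy.1, ?_⟩ : _ ⊆ Set.Icc t M)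
    by_contra hcon
    exact absurd (hM y (not_le.mp hcon).le) (not_lt.mpr hy.2)
  · by_contra! hcon
    obtain ⟨c, hc1, hc2⟩ := EReal.lt_iff_exists_real_btwn.mp hcon
    have h1 : (⨅ x ∈ interior A, (I x : EReal)) < ((-c : ℝ) : EReal) := by
      rw [EReal.coe_neg]
      exact EReal.lt_neg_comm.mp hc2
    simp only [iInf_lt_iff] at h1
    obtain ⟨x, hx, hxc⟩ := h1
    have hxt := hIlt x _ hxc.le
    rw [hIe x hxt, EReal.coe_lt_coe_iff] at hxc
    obtain ⟨η, hη, hηA⟩ := Metric.isOpen_iff.mp isOpen_interior x hx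
    refine absurd (le_liminf_of_le (by isBoundedDefault) ?_) (not_le.mpr hc1)
    filter_upwards [h.lower_bound x hxt η hη (-c) hxc, hspos] with n hn hs
    have h2 := le_log_measure_div_of_exp_le_real hs (hn.trans (measureReal_mono
      (fun ω hω => interior_subset (s := A) (hηA ?_) : _ ⊆ {ω | Y n ω ∈ A})))
    · rwa [neg_neg] at h2
    · rw [Real.ball_eq_Ioo]
      exact ⟨by linarith [hω.1], hω.2⟩
  · by_contra! hcon
    obtain ⟨c, hc1, hc2⟩ := EReal.lt_iff_exists_real_btwn.mp hcon
    have h1 : ((-c : ℝ) : EReal) < ⨅ x ∈ closure A, (I x : EReal) := by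
      rw [EReal.coe_neg]
      exact EReal.neg_lt_comm.mp hc1
    have h2 : ∀ x ∈ closure A, ((-c : ℝ) : EReal) < I x := fun x hx =>
      h1.trans_le (iInf₂_le x hx)
    refine absurd (limsup_le_of_le (by isBoundedDefault) ?_) (not_le.mpr hc2)
    suffices hev : ∀ᶠ n : ℕ in atTop,
        P.real {ω | Y n ω ∈ A} ≤ Real.exp (-(-c * (n : ℝ) ^ q)) by
      filter_upwards [hev, hspos] with n hn hs
      simpa using log_measure_div_le_of_real_le_exp hs hn
    -- If `c > 0`, the claimed bound exceeds 1 and is trivial. Otherwise `-c ≥ 0 = J t` keeps `t`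
    -- out of the closure.
    rcases lt_or_ge 0 c with hc | hc
    · filter_upwards [hspos] with n hs
      refine measureReal_le_one.trans (Real.one_le_exp ?_)
      rw [neg_mul, neg_neg]
      positivity
    have htA : t ∉ closure A := fun ht => by
      have h3 := h2 t ht
      rw [hIe t le_rfl, hJt, EReal.coe_lt_coe_iff] at h3
      linarith
    obtain ⟨ε, hε, hεA⟩ := Metric.isOpen_iff.mp isClosed_closure.isOpen_compl t htA
    obtain ⟨y, hty, hcy, hyA⟩ : ∃ y, t < y ∧ -c < J y ∧
        ∀ x ∈ closure A, t ≤ x → y ≤ x := by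
      -- If nothing of the closure lies above `t`, any `y` far enough out works, as `J` tends to
      -- infinity.
      rcases (closure A ∩ Set.Ici t).eq_empty_or_nonempty with hemp | hne
      · obtain ⟨y, h3, h4⟩ := ((hJtop.eventually_gt_atTop (-c)).and
          (eventually_gt_atTop t)).exists
        exact ⟨y, h4, h3, fun x hx hxt => absurd (hemp ▸ (⟨hx, hxt⟩ : x ∈ closure A ∩ Set.Ici t))
          (Set.notMem_empty x)⟩
      · have hbdd : BddBelow (closure A ∩ Set.Ici t) := ⟨t, fun x hx => hx.2⟩
        obtain ⟨h3, h4⟩ := (isClosed_closure.inter isClosed_Ici).csInf_mem hne hbdd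
        refine ⟨_, lt_of_le_of_ne h4 fun heq => htA (by rw [heq]; exact h3), ?_,
          fun x hx hxt => csInf_le hbdd ⟨hx, hxt⟩⟩
        have h5 := h2 _ h3
        rwa [hIe _ h4, EReal.coe_lt_coe_iff] at h5
    obtain ⟨b, hb, hbJ⟩ := exists_between hcy
    filter_upwards [h.upper_tail y hty b hbJ, h.lower_tail (t - ε) (by linarith) b,
      eventually_const_mul_exp_le hq 2 hb] with n h3 h4 h5
    have hsub : {ω | Y n ω ∈ A} ⊆ {ω | Y n ω ∈ Set.Ici y} ∪ {ω | Y n ω ∈ Set.Iic (t - ε)} := by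
      intro ω hω
      have hω' : Y n ω ∈ closure A := subset_closure hω
      rcases le_or_gt t (Y n ω) with h6 | h6
      · exact Or.inl (hyA _ hω' h6)
      · refine Or.inr ?_
        by_contra h7
        refine hεA ?_ hω'
        rw [Real.ball_eq_Ioo]
        exact ⟨not_le.mp h7, by linarith⟩
    have h6 := (measureReal_mono (μ := P) hsub).trans (measureReal_union_le _ _)
    linarith

end RandomProjection

end

/-! ### Assembly of the theorem -/

theorem theorem1p2 {Ω : Type*} [MeasurableSpace Ω] (P : Measure Ω) [IsProbabilityMeasure P]
    (p : ℝ) (hp1 : 1 ≤ p) (hp2 : p < 2)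
    (k : ℕ → ℕ) (hk : ∀ n, k n ≤ n) (hk1 : ∀ n, 1 ≤ n → 1 ≤ k n)
    (lam : ℝ) (hlam0 : 0 < lam) (hlam1 : lam ≤ 1)
    (hlim : Tendsto (fun n => (k n : ℝ) / (n : ℝ)) atTop (𝓝 lam))
    (X : ∀ n, Ω → EuclideanSpace ℝ (Fin n))
    (E : ∀ n, Ω → RandomProjection.Grassmannian n (k n))
    (hXm : ∀ n, 1 ≤ n → Measurable (X n)) (hEm : ∀ n, 1 ≤ n → Measurable (E n))
    (hX : ∀ n, 1 ≤ n → pdf.IsUniform (X n) (RandomProjection.lpBall n p) P volume)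
    (hE : ∀ n, 1 ≤ n → P.map (E n) = RandomProjection.grassmannianHaar (hk n))
    (hXE : ∀ n, 1 ≤ n → IndepFun (X n) (E n) P) :
    (IsProbabilityMeasure (RandomProjection.genGaussian p) ∧
      Integrable (fun z : ℝ => z ^ 2) (RandomProjection.genGaussian p) ∧
      ∫ z, z ^ 2 ∂(RandomProjection.genGaussian p) = RandomProjection.mConst p) ∧
    RandomProjection.SatisfiesLDP P
      (fun n ω => RandomProjection.normalizedProjNorm p (E n ω) (X n ω))
      (fun n => (n : ℝ) ^ (p / 2))
      (RandomProjection.rateFunction p lam) := by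
  open RandomProjection in
  have hp : 0 < p := by linarith
  have hq : 0 < p / 2 := by positivity
  refine ⟨⟨isProbabilityMeasure_genGaussian hp, integrable_genGaussian_sq hp,
    integral_genGaussian_sq hp⟩, ?_⟩
  have hm := mConst_pos hp
  -- At the threshold `y = √(λ m_p)` the argument `y²/λ` equals `m_p`, so the rate starts from 0
  -- there.
  have hsq : √(lam * mConst p) ^ 2 / lam = mConst p := by
    rw [Real.sq_sqrt (by positivity)]
    field_simp
  have hle : ∀ y ∈ Set.Ici √(lam * mConst p), mConst p ≤ y ^ 2 / lam := fun y hy => by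
    refine hsq.symm.le.trans ?_
    have : √(lam * mConst p) ≤ y := hy
    gcongr
  have hY := (oneSidedLDP_normalizedProjNorm_sq hp hp2 hk hlam0 hlim hXm hEm hX hE hXE).of_sq
    fun n ω => by unfold normalizedProjNorm; positivity
  refine hY.satisfiesLDP hq ?_ ?_ ?_ ?_ (fun y hy => ?_) fun y hy => ?_
  · exact (continuous_secondMomentRate hp).comp (by fun_prop)
  · intro x hx y hy hxy
    have hx0 : 0 ≤ x := (Real.sqrt_nonneg _).trans hx
    have hx1 := sub_nonneg.mpr (hle x hx)
    simp only [secondMomentRate]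
    gcongr
  · simp [secondMomentRate, hsq, hq.ne']
  · unfold secondMomentRate
    refine Tendsto.const_mul_atTop (by positivity) ((tendsto_rpow_atTop hq).comp ?_)
    exact tendsto_atTop_add_const_right _ _
      ((tendsto_pow_atTop two_ne_zero).atTop_div_const hlam0)
  · exact if_pos hy
  · exact if_neg (not_le.mpr hy)
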